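/- Let $\mathcal F(\mathbb R^n)$ be the set of lower semicontinuous convex functions $f:\mathbb R^n\to\mathbb R\cup\{+\infty\}$ that are not identically $+\infty$, and for $f\in\mathcal F(\mathbb R^n)$ let $f^*(y)=\sup_{x\in\mathbb R^n}\{x\cdot y-f(x)\}$ be its Fenchel–Legendre transform. Let $\mathcal P_1(\mathbb R^n)$ be the set of Borel probability measures $\nu$ on $\mathbb R^n$ with $\int|x|\,d\nu<+\infty$. For a Borel measure $m$ on $\mathbb R^n$ put, with values in $[-\infty,+\infty]$, \[ L(f|m)=-\log\int e^{-f^*}\,dm\quad (f\in\mathcal F(\mathbb R^n)),\qquad K(\nu|m)=\sup_{g\in L^1(\nu)\cap\mathcal F(\mathbb R^n)}\Big\{\int(-g)\,d\nu-L(g|m)\Big\}\quad(\nu\in\mathcal P_1(\mathbb R^n)), \] where $\log 0=-\infty$ and $\log(+\infty)=+\infty$. For $f\in\mathcal F(\mathbb R^n)$ and $\nu\in\mathcal P_1(\mathbb R^n)$ the integral $\int(-f)\,d\nu$ is well defined in $\mathbb R\cup\{-\infty\}$; in the suprema below, the difference $\int(-f)\,d\nu-K(\nu|m)$ is taken to be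 $-\infty$ when $\int(-f)\,d\nu=-\infty$. A function $f$ (resp. a measure $\mu$) on $\mathbb R^n$ is called unconditional if it is invariant under all maps $(x_1,\dots,x_n)\mapsto(\varepsilon_1x_1,\dots,\varepsilon_nx_n)$ with $\varepsilon\in\{-1,1\}^n$, and symmetric if it is invariant under $x\mapsto-x$. **Theorem.** Let $m$ be an absolutely continuous log-concave measure on $\mathbb R^n$ (not necessarily finite), that is, $dm=e^{-V}dx$ with $V:\mathbb R^n\to\mathbb R\cup\{+\infty\}$ convex. For every $f\in\mathcal F(\mathbb R^n)$ such that $\int e^{-f^*}\,dm>0$, \[ \sup_{\nu\in\mathcal P_1(\mathbb R^n)}\Big\{\int(-f)\,d\nu-K(\nu|m)\Big\}=L(f|m). \] If moreover $m$ and $f$ are unconditional (resp. symmetric), then the equality also holds with the supremum restricted to the unconditional (resp. symmetric) measures $\nu\in\mathcal P_1(\mathbb R^n)$. -/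

import Mathlib

open MeasureTheory
open scoped ENNReal

namespace ReverseDuality

noncomputable section

/-- Convexity of a function with values in `ℝ ∪ {+∞}`
(the value `-∞` is excluded separately wherever this is used). -/
def EConvex {n : ℕ} (f : EuclideanSpace ℝ (Fin n) → EReal) : Prop :=
  ∀ x y : EuclideanSpace ℝ (Fin n), ∀ a b : ℝ, 0 ≤ a → 0 ≤ b → a + b = 1 →
    f (a • x + b • y) ≤ (a : EReal) * f x + (b : EReal) * f y

/-- The class `F(ℝⁿ)`: lower semicontinuous convex functions `ℝⁿ → ℝ ∪ {+∞}` with a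
non-empty domain. -/
structure IsProperConvexLSC {n : ℕ} (f : EuclideanSpace ℝ (Fin n) → EReal) : Prop where
  ne_bot : ∀ x, f x ≠ ⊥
  convex : EConvex f
  lsc : LowerSemicontinuous f
  exists_lt_top : ∃ x, f x < ⊤

/-- The Fenchel-Legendre transform `f*(y) = sup_x {x · y - f(x)}`. -/
def conj {n : ℕ} (f : EuclideanSpace ℝ (Fin n) → EReal) (y : EuclideanSpace ℝ (Fin n)) : EReal :=
  ⨆ x : EuclideanSpace ℝ (Fin n), (((inner ℝ x y : ℝ) : EReal) - f x)

/-- The measures `dm = e^{-V} dx` with `V : ℝⁿ → ℝ ∪ {+∞}` convex (absolutely continuous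
log-concave measures, not necessarily finite). -/
def IsLogConcave {n : ℕ} (m : Measure (EuclideanSpace ℝ (Fin n))) : Prop :=
  ∃ V : EuclideanSpace ℝ (Fin n) → EReal, (∀ x, V x ≠ ⊥) ∧ EConvex V ∧
    m = volume.withDensity (fun x => EReal.exp (-V x))

/-- `∫ e^{-f*} dm`, an element of `[0, ∞]`. -/
def expConjIntegral {n : ℕ} (f : EuclideanSpace ℝ (Fin n) → EReal)
    (m : Measure (EuclideanSpace ℝ (Fin n))) : ℝ≥0∞ :=
  ∫⁻ y, EReal.exp (-conj f y) ∂m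

/-- `L(f|m) = -log ∫ e^{-f*} dm`, with `log 0 = -∞` and `log ∞ = +∞`. -/
def L {n : ℕ} (f : EuclideanSpace ℝ (Fin n) → EReal)
    (m : Measure (EuclideanSpace ℝ (Fin n))) : EReal :=
  -ENNReal.log (expConjIntegral f m)

/-- The integral `∫ g dν = ∫ g⁺ dν - ∫ g⁻ dν` of an extended-real-valued function, meaningful as
soon as one of the two terms is finite. -/
def eintegral {n : ℕ} (g : EuclideanSpace ℝ (Fin n) → EReal)
    (ν : Measure (EuclideanSpace ℝ (Fin n))) : EReal :=
  ((∫⁻ x, (g x).toENNReal ∂ν : ℝ≥0∞) : EReal) - ((∫⁻ x, (-g x).toENNReal ∂ν : ℝ≥0∞) : EReal)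

/-- `f ∈ L¹(ν)` for an extended-real-valued function. -/
def IsL1 {n : ℕ} (f : EuclideanSpace ℝ (Fin n) → EReal)
    (ν : Measure (EuclideanSpace ℝ (Fin n))) : Prop :=
  AEMeasurable f ν ∧ ∫⁻ x, (f x).abs ∂ν < ∞

/-- `K(ν|m) = sup {∫ (-f) dν - L(f|m) : f ∈ L¹(ν) ∩ F(ℝⁿ)}`. -/
def K {n : ℕ} (ν m : Measure (EuclideanSpace ℝ (Fin n))) : EReal :=
  ⨆ f ∈ {f : EuclideanSpace ℝ (Fin n) → EReal | IsL1 f ν ∧ IsProperConvexLSC f},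
    (eintegral (fun x => -f x) ν - L f m)

/-- Borel probability measures on `ℝⁿ` with a finite first moment. -/
def P1 (n : ℕ) : Set (Measure (EuclideanSpace ℝ (Fin n))) :=
  {ν | IsProbabilityMeasure ν ∧ ∫⁻ x, ‖x‖ₑ ∂ν < ∞}

/-- `ε ∈ {-1, 1}ⁿ`. -/
def IsSigns {n : ℕ} (ε : Fin n → ℝ) : Prop := ∀ i, ε i = 1 ∨ ε i = -1

/-- The map `(x₁, …, xₙ) ↦ (ε₁ x₁, …, εₙ xₙ)`. -/
def signFlip {n : ℕ} (ε : Fin n → ℝ) (x : EuclideanSpace ℝ (Fin n)) :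
    EuclideanSpace ℝ (Fin n) :=
  WithLp.toLp 2 (fun i => ε i * x i)

def UnconditionalFun {n : ℕ} (f : EuclideanSpace ℝ (Fin n) → EReal) : Prop :=
  ∀ ε : Fin n → ℝ, IsSigns ε → ∀ x, f (signFlip ε x) = f x

def SymmetricFun {n : ℕ} (f : EuclideanSpace ℝ (Fin n) → EReal) : Prop :=
  ∀ x, f (-x) = f x

def UnconditionalMeasure {n : ℕ} (μ : Measure (EuclideanSpace ℝ (Fin n))) : Prop :=
  ∀ ε : Fin n → ℝ, IsSigns ε → μ.map (signFlip ε) = μ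

def SymmetricMeasure {n : ℕ} (μ : Measure (EuclideanSpace ℝ (Fin n))) : Prop :=
  μ.map (fun x => -x) = μ

end

end ReverseDuality

open scoped Pointwise

namespace ReverseDuality

/-! The inequality `≤` is Fenchel–Young: if `f` is in L¹(ν), it competes in the supremum defining
`K`; otherwise an affine minorant of `f` and the first moment of ν force ∫(-f)dν = -∞.

For `≥`, assume ∫e^{-f*}dm finite, since otherwise L(f|m) = -∞. Let φ_k be the Legendre transform of
`f` restricted to the ball of radius k. It is convex, k-Lipschitz and increases to f*. Let Z_k =
∫e^{-φ_k}dm and let ν_k be the image of e^{-φ_k}dm/Z_k under ∇φ_k. This measure lives on the ball,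
and f(∇φ_k(y)) = y·∇φ_k(y) - φ_k(y) almost everywhere. The core estimate
(`IsGibbsPair.expConjIntegral_le`) says that ν_k yields a subgradient: ∫e^{-g*}dm ≤ Z_k exp(∫g dν_k
- ∫f dν_k) for every admissible g. Equivalently K(ν_k|m) ≤ -∫f dν_k + log Z_k, so ν_k gives the
functional a value at least -log Z_k.

The estimate is Prékopa–Leindler (`prekopaLeindler`) applied to e^{-φ_k-V} and e^{-g*-V} with
weights 1-t and t, then differentiated at t = 0 (`le_integral_of_exp_le`). Finally Z_k decreases to
∫e^{-f*}dm. Monotone convergence needs some Z_k to be finite, which comes from the linear growth in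
`EConvex.eventually_exists_linear_le`. Invariance of `m` and `f` under a linear isometry passes to
ν_k, which gives the restricted suprema. -/

/-! ### The Prékopa–Leindler inequality. -/

/-- One-dimensional Brunn–Minkowski inequality, for compact sets. -/
theorem volume_convexComb_le_of_isCompact {A B C : Set ℝ} (hA : IsCompact A) (hB : IsCompact B)
    (nA : A.Nonempty) (nB : B.Nonempty) {a b : ℝ} (ha : 0 < a) (hb : 0 < b)
    (hC : ∀ x ∈ A, ∀ y ∈ B, a * x + b * y ∈ C) :
    ENNReal.ofReal a * volume A + ENNReal.ofReal b * volume B ≤ volume C := by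
  obtain ⟨α, hα, hαm⟩ := hA.exists_isGreatest nA
  obtain ⟨β, hβ, hβm⟩ := hB.exists_isLeast nB
  have image_vol : ∀ (S : Set ℝ) (c d : ℝ), 0 < c →
      volume ((fun x => c * x + d) '' S) = ENNReal.ofReal c * volume S := by
    intro S c d hc
    have : (fun x => c * x + d) '' S = (fun x => x + d) '' (c • S) := by
      ext x; simp [Set.mem_smul_set, ← sub_eq_add_neg, eq_sub_iff_add_eq]
    rw [this, Set.image_add_right, measure_preimage_add_right, Measure.addHaar_smul]
    simp [abs_of_pos hc]
  -- With α the maximum of A and β the minimum of B, the copies aA + bβ and aα + bB both lie in C,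
  -- on opposite sides of p, and share at most the point p.
  set p := a * α + b * β with hp
  have h1 : ENNReal.ofReal a * volume A ≤ volume (C ∩ Set.Iic p) := by
    rw [← image_vol A a (b * β) ha]
    refine measure_mono ?_
    rintro _ ⟨x, hx, rfl⟩
    refine ⟨hC x hx β hβ, ?_⟩
    have := hαm hx
    simp only [Set.mem_Iic, hp]
    gcongr
  have h2 : ENNReal.ofReal b * volume B ≤ volume (C \ Set.Iic p) := by
    rw [← image_vol B b (a * α) hb]
    have : (fun x => b * x + a * α) '' B ⊆ (C \ Set.Iic p) ∪ {p} := by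
      rintro _ ⟨y, hy, rfl⟩
      have h3 := hβm hy
      have h4 : p ≤ b * y + a * α := by
        rw [hp, add_comm]; gcongr
      rcases h4.eq_or_lt with h | h
      · right; exact h.symm
      · left
        refine ⟨?_, not_le.2 h⟩
        have := hC α hα y hy
        rwa [add_comm] at this
    refine (measure_mono this).trans ((measure_union_le _ _).trans ?_)
    simp
  calc _ ≤ volume (C ∩ Set.Iic p) + volume (C \ Set.Iic p) := add_le_add h1 h2
    _ = volume C := measure_inter_add_sdiff _ measurableSet_Iic

/-- One-dimensional Brunn–Minkowski inequality. -/
theorem volume_convexComb_le {A B C : Set ℝ} (hA : MeasurableSet A) (hB : MeasurableSet B)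
    (nA : A.Nonempty) (nB : B.Nonempty) {a b : ℝ} (ha : 0 < a) (hb : 0 < b)
    (hC : ∀ x ∈ A, ∀ y ∈ B, a * x + b * y ∈ C) :
    ENNReal.ofReal a * volume A + ENNReal.ofReal b * volume B ≤ volume C := by
  obtain ⟨x₀, hx₀⟩ := nA
  obtain ⟨y₀, hy₀⟩ := nB
  -- Inner regularity, one set at a time. Subtracting d requires d finite; for d = ⊤ the bound d ≤ z
  -- already decides.
  have key : ∀ {c : ℝ} {S : Set ℝ} {d z : ℝ≥0∞}, 0 < c → MeasurableSet S → d ≤ z →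
      (d ≠ ⊤ → ∀ K ⊆ S, IsCompact K → ENNReal.ofReal c * volume K + d ≤ z) →
      ENNReal.ofReal c * volume S + d ≤ z := by
    intro c S d z hc hS hdz h
    by_cases hd : d = ⊤
    · have : z = ⊤ := by rw [hd] at hdz; exact top_le_iff.1 hdz
      simp [this]
    have hc0 : ENNReal.ofReal c ≠ 0 := by simpa using hc
    have : volume S ≤ (z - d) / ENNReal.ofReal c := by
      rw [hS.measure_eq_iSup_isCompact]
      refine iSup₂_le fun K hK => iSup_le fun hKc => ?_
      rw [ENNReal.le_div_iff_mul_le (Or.inl hc0) (Or.inl ENNReal.ofReal_ne_top), mul_comm]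
      exact ENNReal.le_sub_of_add_le_right hd (h hd K hK hKc)
    rw [ENNReal.le_div_iff_mul_le (Or.inl hc0) (Or.inl ENNReal.ofReal_ne_top), mul_comm] at this
    calc _ ≤ (z - d) + d := by gcongr
      _ = z := tsub_add_cancel_of_le hdz
  have step : ∀ K ⊆ A, ∀ K' ⊆ B, IsCompact K → IsCompact K' →
      ENNReal.ofReal a * volume K + ENNReal.ofReal b * volume K' ≤ volume C := by
    intro K hK K' hK' hc hc'
    -- Adding a point of each set makes the compact subsets nonempty, so that K = ∅ is allowed; this
    -- case supplies the condition d ≤ z of `key`.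
    calc _ ≤ ENNReal.ofReal a * volume (insert x₀ K) + ENNReal.ofReal b * volume (insert y₀ K') := by
          gcongr <;> exact Set.subset_insert _ _
      _ ≤ volume C := volume_convexComb_le_of_isCompact (hc.insert x₀) (hc'.insert y₀)
          (Set.insert_nonempty _ _) (Set.insert_nonempty _ _) ha hb
          fun x hx y hy => hC x (Set.insert_subset hx₀ hK hx) y (Set.insert_subset hy₀ hK' hy)
  have step1 : ∀ K' ⊆ B, IsCompact K' →
      ENNReal.ofReal a * volume A + ENNReal.ofReal b * volume K' ≤ volume C := by
    intro K' hK' hc'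
    refine key ha hA ?_ fun _ K hK hc => step K hK K' hK' hc hc'
    simpa using step ∅ (Set.empty_subset _) K' hK' isCompact_empty hc'
  rw [add_comm]
  refine key hb hB ?_ fun _ K hK hc => ?_
  · simpa using step1 ∅ (Set.empty_subset _) isCompact_empty
  · rw [add_comm]; exact step1 K hK hc

/-- Layer-cake formula, by Tonelli on the region under the graph; the value ⊤ is allowed. -/
theorem lintegral_eq_lintegral_measure_ofReal_lt {f : ℝ → ℝ≥0∞} (hf : Measurable f) :
    ∫⁻ x, f x = ∫⁻ s in Set.Ioi (0 : ℝ), volume {x | ENNReal.ofReal s < f x} := by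
  have slice : ∀ c : ℝ≥0∞, ∫⁻ s in Set.Ioi (0 : ℝ),
      Set.indicator {s : ℝ | ENNReal.ofReal s < c} 1 s = c := by
    intro c
    have hm : MeasurableSet {s : ℝ | ENNReal.ofReal s < c} :=
      measurableSet_lt ENNReal.measurable_ofReal measurable_const
    rw [lintegral_indicator_one hm, Measure.restrict_apply hm]
    induction c with
    | top => simp
    | coe c =>
      have : {s : ℝ | ENNReal.ofReal s < c} ∩ Set.Ioi 0 = Set.Ioo 0 (c : ℝ) := by
        ext s
        simp only [Set.mem_inter_iff, Set.mem_ofPred_eq, Set.mem_Ioi, Set.mem_Ioo]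
        constructor
        · rintro ⟨h1, h2⟩
          exact ⟨h2, by simpa using ENNReal.ofReal_lt_coe_iff h2.le |>.1 h1⟩
        · rintro ⟨h1, h2⟩
          exact ⟨(ENNReal.ofReal_lt_coe_iff h1.le).2 h2, h1⟩
      rw [this]; simp
  have hms : MeasurableSet {p : ℝ × ℝ | ENNReal.ofReal p.2 < f p.1} :=
    measurableSet_lt (ENNReal.measurable_ofReal.comp measurable_snd) (hf.comp measurable_fst)
  calc ∫⁻ x, f x = ∫⁻ x, ∫⁻ s in Set.Ioi (0 : ℝ),
        Set.indicator {p : ℝ × ℝ | ENNReal.ofReal p.2 < f p.1} 1 (x, s) := by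
        refine lintegral_congr fun x => ?_
        conv_lhs => rw [← slice (f x)]
        rfl
    _ = ∫⁻ s in Set.Ioi (0 : ℝ), ∫⁻ x,
        Set.indicator {p : ℝ × ℝ | ENNReal.ofReal p.2 < f p.1} 1 (x, s) :=
        lintegral_lintegral_swap ((measurable_const.indicator hms).aemeasurable)
    _ = _ := by
        refine lintegral_congr fun s => ?_
        have hm : MeasurableSet {x : ℝ | ENNReal.ofReal s < f x} :=
          measurableSet_lt measurable_const hf
        rw [← lintegral_indicator_one hm]
        rfl

theorem ennreal_geom_mean_le_arith_mean2_weighted {a b : ℝ} (ha : 0 < a) (hb : 0 < b)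
    (hab : a + b = 1) (x y : ℝ≥0∞) :
    x ^ a * y ^ b ≤ ENNReal.ofReal a * x + ENNReal.ofReal b * y := by
  have ha0 : ENNReal.ofReal a ≠ 0 := by simpa using ha
  have hb0 : ENNReal.ofReal b ≠ 0 := by simpa using hb
  induction x with
  | top => rw [ENNReal.mul_top ha0]; simp
  | coe x =>
  induction y with
  | top => rw [ENNReal.mul_top hb0]; simp
  | coe y =>
    rw [← ENNReal.coe_rpow_of_nonneg _ ha.le, ← ENNReal.coe_rpow_of_nonneg _ hb.le]
    lift a to NNReal using ha.le
    lift b to NNReal using hb.le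
    have := NNReal.geom_mean_le_arith_mean2_weighted a b x y (by exact_mod_cast hab)
    rw [ENNReal.ofReal_coe_nnreal, ENNReal.ofReal_coe_nnreal]
    exact_mod_cast this

/-- Since the suprema agree, the superlevel sets of u and v are both nonempty below level 1 and both
empty from level 1 on. Brunn–Minkowski on each level then bounds even the arithmetic mean of the
integrals. -/
theorem prekopaLeindler_of_iSup_eq_one {a b : ℝ} (ha : 0 < a) (hb : 0 < b) (hab : a + b = 1)
    {u v w : ℝ → ℝ≥0∞} (hu : Measurable u) (hv : Measurable v) (hw : Measurable w)
    (su : ⨆ x, u x = 1) (sv : ⨆ x, v x = 1)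
    (h : ∀ x y, u x ^ a * v y ^ b ≤ w (a * x + b * y)) :
    (∫⁻ x, u x) ^ a * (∫⁻ x, v x) ^ b ≤ ∫⁻ x, w x := by
  refine (ennreal_geom_mean_le_arith_mean2_weighted ha hb hab _ _).trans ?_
  rw [lintegral_eq_lintegral_measure_ofReal_lt hu, lintegral_eq_lintegral_measure_ofReal_lt hv,
    lintegral_eq_lintegral_measure_ofReal_lt hw]
  have anti : ∀ g : ℝ → ℝ≥0∞, Measurable fun s : ℝ => volume {x | ENNReal.ofReal s < g x} := by
    intro g
    refine Antitone.measurable fun s t hst => measure_mono fun x hx => ?_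
    exact (ENNReal.ofReal_le_ofReal hst).trans_lt hx
  rw [← lintegral_const_mul _ (anti u), ← lintegral_const_mul _ (anti v),
    ← lintegral_add_left ((anti u).const_mul _)]
  refine setLIntegral_mono (anti w) fun s hs => ?_
  rcases lt_or_ge s 1 with hs1 | hs1
  · have hlt : ENNReal.ofReal s < 1 := by simpa using hs1
    obtain ⟨x₀, hx₀⟩ := lt_iSup_iff.1 (hlt.trans_eq su.symm)
    obtain ⟨y₀, hy₀⟩ := lt_iSup_iff.1 (hlt.trans_eq sv.symm)
    refine volume_convexComb_le (measurableSet_lt measurable_const hu)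
      (measurableSet_lt measurable_const hv) ⟨x₀, hx₀⟩ ⟨y₀, hy₀⟩ ha hb fun x hx y hy => ?_
    refine lt_of_lt_of_le ?_ (h x y)
    have hs0 : ENNReal.ofReal s ≠ 0 := by simpa using hs
    calc ENNReal.ofReal s = ENNReal.ofReal s ^ a * ENNReal.ofReal s ^ b := by
          rw [← ENNReal.rpow_add _ _ hs0 ENNReal.ofReal_ne_top, hab, ENNReal.rpow_one]
      _ < u x ^ a * v y ^ b :=
          ENNReal.mul_lt_mul (ENNReal.rpow_lt_rpow hx ha) (ENNReal.rpow_lt_rpow hy hb)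
  · have hge : 1 ≤ ENNReal.ofReal s := by simpa using hs1
    have e1 : {x | ENNReal.ofReal s < u x} = ∅ := by
      ext x; simpa using ((le_iSup u x).trans_eq su).trans hge
    have e2 : {x | ENNReal.ofReal s < v x} = ∅ := by
      ext x; simpa using ((le_iSup v x).trans_eq sv).trans hge
    simp [e1, e2]

theorem prekopaLeindler_of_iSup_ne_top {a b : ℝ} (ha : 0 < a) (hb : 0 < b) (hab : a + b = 1)
    {u v w : ℝ → ℝ≥0∞} (hu : Measurable u) (hv : Measurable v) (hw : Measurable w)
    (su : ⨆ x, u x ≠ ⊤) (sv : ⨆ x, v x ≠ ⊤)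
    (h : ∀ x y, u x ^ a * v y ^ b ≤ w (a * x + b * y)) :
    (∫⁻ x, u x) ^ a * (∫⁻ x, v x) ^ b ≤ ∫⁻ x, w x := by
  set M := ⨆ x, u x with hM
  set N := ⨆ x, v x with hN
  by_cases hM0 : M = 0
  · have : ∀ x, u x = 0 := fun x => le_zero_iff.1 ((le_iSup u x).trans_eq hM0)
    simp [this, ha]
  by_cases hN0 : N = 0
  · have : ∀ x, v x = 0 := fun x => le_zero_iff.1 ((le_iSup v x).trans_eq hN0)
    simp [this, hb]
  have hMi : M⁻¹ ≠ ⊤ := ENNReal.inv_ne_top.2 hM0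
  have hNi : N⁻¹ ≠ ⊤ := ENNReal.inv_ne_top.2 hN0
  have key := prekopaLeindler_of_iSup_eq_one ha hb hab (hu.const_mul M⁻¹) (hv.const_mul N⁻¹)
    (hw.const_mul (M⁻¹ ^ a * N⁻¹ ^ b))
    (by rw [← ENNReal.mul_iSup, ← hM, ENNReal.inv_mul_cancel hM0 su])
    (by rw [← ENNReal.mul_iSup, ← hN, ENNReal.inv_mul_cancel hN0 sv])
    (fun x y => by
      rw [ENNReal.mul_rpow_of_nonneg _ _ ha.le, ENNReal.mul_rpow_of_nonneg _ _ hb.le,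
        mul_mul_mul_comm]
      gcongr
      exact h x y)
  rw [lintegral_const_mul _ hu, lintegral_const_mul _ hv, lintegral_const_mul _ hw,
    ENNReal.mul_rpow_of_nonneg _ _ ha.le, ENNReal.mul_rpow_of_nonneg _ _ hb.le,
    mul_mul_mul_comm] at key
  refine (ENNReal.mul_le_mul_iff_right ?_ ?_).1 key
  · refine mul_ne_zero ?_ ?_ <;> simp [su, sv, ha.not_gt, hb.not_gt]
  · exact ENNReal.mul_ne_top (ENNReal.rpow_ne_top_of_nonneg ha.le hMi)
      (ENNReal.rpow_ne_top_of_nonneg hb.le hNi)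

theorem lintegral_eq_iSup_lintegral_min {u : ℝ → ℝ≥0∞} (hu : Measurable u) :
    ∫⁻ x, u x = ⨆ k : ℕ, ∫⁻ x, min (u x) k := by
  rw [← lintegral_iSup (fun k => hu.min measurable_const)
    (fun i j hij x => min_le_min_left _ (by exact_mod_cast hij))]
  refine lintegral_congr fun x => ?_
  rw [← inf_iSup_eq, ENNReal.iSup_natCast, inf_top_eq]

/-- Prékopa–Leindler inequality on the line. -/
theorem prekopaLeindler_real {a b : ℝ} (ha : 0 < a) (hb : 0 < b) (hab : a + b = 1)
    {u v w : ℝ → ℝ≥0∞} (hu : Measurable u) (hv : Measurable v) (hw : Measurable w)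
    (h : ∀ x y, u x ^ a * v y ^ b ≤ w (a * x + b * y)) :
    (∫⁻ x, u x) ^ a * (∫⁻ x, v x) ^ b ≤ ∫⁻ x, w x := by
  rw [lintegral_eq_iSup_lintegral_min hu, lintegral_eq_iSup_lintegral_min hv]
  have e : ∀ (c : ℝ) (hc : 0 < c) (s : ℕ → ℝ≥0∞), (⨆ k, s k) ^ c = ⨆ k, s k ^ c :=
    fun c hc s => (ENNReal.orderIsoRpow c hc).map_iSup s
  rw [e a ha, e b hb, ENNReal.iSup_mul]
  refine iSup_le fun k => ?_
  rw [ENNReal.mul_iSup]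
  refine iSup_le fun l => ?_
  refine prekopaLeindler_of_iSup_ne_top ha hb hab (hu.min measurable_const)
    (hv.min measurable_const) hw ?_ ?_ fun x y => le_trans ?_ (h x y)
  · exact ne_top_of_le_ne_top (ENNReal.natCast_ne_top k) (iSup_le fun x => min_le_right _ _)
  · exact ne_top_of_le_ne_top (ENNReal.natCast_ne_top l) (iSup_le fun x => min_le_right _ _)
  · gcongr <;> exact min_le_left _ _

/-- Induction on the dimension: the inductive hypothesis on the fibres over the first coordinate
says that the marginals satisfy the one-dimensional hypothesis. -/
theorem prekopaLeindler_pi {a b : ℝ} (ha : 0 < a) (hb : 0 < b) (hab : a + b = 1) (n : ℕ)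
    {u v w : (Fin n → ℝ) → ℝ≥0∞} (hu : Measurable u) (hv : Measurable v) (hw : Measurable w)
    (h : ∀ x y, u x ^ a * v y ^ b ≤ w (a • x + b • y)) :
    (∫⁻ x, u x) ^ a * (∫⁻ x, v x) ^ b ≤ ∫⁻ x, w x := by
  induction n with
  | zero =>
    have e : ∀ g : (Fin 0 → ℝ) → ℝ≥0∞, ∫⁻ x, g x = g 0 := by
      intro g
      rw [lintegral_unique, volume_pi, Measure.pi_empty_univ, mul_one]
      exact congrArg g (Subsingleton.elim _ _)
    rw [e, e, e]
    convert h 0 0 using 2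
  | succ n ih =>
    let Φ := MeasurableEquiv.piFinSuccAbove (fun _ : Fin (n + 1) => ℝ) 0
    have hΦ : MeasurePreserving Φ.symm :=
      (volume_preserving_piFinSuccAbove (fun _ : Fin (n + 1) => ℝ) 0).symm _
    have mΦ : ∀ {g : (Fin (n + 1) → ℝ) → ℝ≥0∞}, Measurable g →
        Measurable fun p : ℝ × (Fin n → ℝ) => g (Φ.symm p) := fun hg => hg.comp Φ.symm.measurable
    have e : ∀ {g : (Fin (n + 1) → ℝ) → ℝ≥0∞}, Measurable g →
        ∫⁻ x, g x = ∫⁻ s, ∫⁻ y, g (Φ.symm (s, y)) := by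
      intro g hg
      rw [← hΦ.lintegral_comp hg, Measure.volume_eq_prod, lintegral_prod _ (mΦ hg).aemeasurable]
    have lin : ∀ p q : ℝ × (Fin n → ℝ), Φ.symm (a • p + b • q) =
        a • Φ.symm p + b • Φ.symm q := by
      intro p q
      ext i
      refine Fin.cases ?_ (fun i => ?_) i <;>
        simp [Φ, MeasurableEquiv.piFinSuccAbove, Fin.insertNthEquiv]
    rw [e hu, e hv, e hw]
    refine prekopaLeindler_real ha hb hab (mΦ hu).lintegral_prod_right'
      (mΦ hv).lintegral_prod_right' (mΦ hw).lintegral_prod_right' fun s t => ?_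
    refine ih ((mΦ hu).comp measurable_prodMk_left) ((mΦ hv).comp measurable_prodMk_left)
      ((mΦ hw).comp measurable_prodMk_left) fun x y => ?_
    refine (h _ _).trans_eq ?_
    rw [← lin]
    rfl

/-- Prékopa–Leindler inequality. -/
theorem prekopaLeindler {n : ℕ} {a b : ℝ} (ha : 0 < a) (hb : 0 < b) (hab : a + b = 1)
    {u v w : EuclideanSpace ℝ (Fin n) → ℝ≥0∞} (hu : Measurable u) (hv : Measurable v)
    (hw : Measurable w) (h : ∀ x y, u x ^ a * v y ^ b ≤ w (a • x + b • y)) :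
    (∫⁻ x, u x) ^ a * (∫⁻ x, v x) ^ b ≤ ∫⁻ x, w x := by
  have mp := PiLp.volume_preserving_toLp (Fin n)
  rw [← mp.lintegral_comp hu, ← mp.lintegral_comp hv, ← mp.lintegral_comp hw]
  exact prekopaLeindler_pi ha hb hab n (hu.comp mp.measurable) (hv.comp mp.measurable)
    (hw.comp mp.measurable) fun x y => h _ _

variable {n : ℕ}

/-! ### Convex functions with extended-real values. -/

theorem EConvex.le_coe {W : EuclideanSpace ℝ (Fin n) → EReal} (hW : EConvex W)
    {x y : EuclideanSpace ℝ (Fin n)} {a b c d : ℝ} (ha : 0 ≤ a) (hb : 0 ≤ b) (hab : a + b = 1)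
    (hx : W x ≤ (c : EReal)) (hy : W y ≤ (d : EReal)) :
    W (a • x + b • y) ≤ ((a * c + b * d : ℝ) : EReal) := by
  refine (hW x y a b ha hb hab).trans ?_
  rw [EReal.coe_add, EReal.coe_mul, EReal.coe_mul]
  exact add_le_add (mul_le_mul_of_nonneg_left hx (EReal.coe_nonneg.2 ha))
    (mul_le_mul_of_nonneg_left hy (EReal.coe_nonneg.2 hb))

theorem EConvex.convex_sublevel {W : EuclideanSpace ℝ (Fin n) → EReal} (hW : EConvex W) (c : ℝ) :
    Convex ℝ {x | W x ≤ (c : EReal)} := by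
  intro x hx y hy a b ha hb hab
  have := hW.le_coe ha hb hab hx hy
  rwa [← add_mul, hab, one_mul] at this

theorem EConvex.convex_dom {W : EuclideanSpace ℝ (Fin n) → EReal} (hW : EConvex W) :
    Convex ℝ {x | W x < ⊤} := by
  intro x hx y hy a b ha hb hab
  obtain ⟨c, hc, -⟩ := EReal.lt_iff_exists_real_btwn.1 (show W x < ⊤ from hx)
  obtain ⟨d, hd, -⟩ := EReal.lt_iff_exists_real_btwn.1 (show W y < ⊤ from hy)
  exact (hW.le_coe ha hb hab hc.le hd.le).trans_lt (EReal.coe_lt_top _)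

theorem EConvex.add {U W : EuclideanSpace ℝ (Fin n) → EReal} (hU : EConvex U) (hW : EConvex W) :
    EConvex fun x => U x + W x := by
  intro x y a b ha hb hab
  refine (add_le_add (hU x y a b ha hb hab) (hW x y a b ha hb hab)).trans_eq ?_
  rw [EReal.left_distrib_of_nonneg_of_ne_top (EReal.coe_nonneg.2 ha) (EReal.coe_ne_top a),
    EReal.left_distrib_of_nonneg_of_ne_top (EReal.coe_nonneg.2 hb) (EReal.coe_ne_top b)]
  abel

/-- A convex function agrees almost everywhere with a Borel measurable convex function. -/
theorem EConvex.exists_measurable {V : EuclideanSpace ℝ (Fin n) → EReal} (hV : EConvex V)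
    (hb : ∀ x, V x ≠ ⊥) :
    ∃ V' : EuclideanSpace ℝ (Fin n) → EReal, EConvex V' ∧ (∀ x, V' x ≠ ⊥) ∧ Measurable V' ∧
      V =ᵐ[volume] V' := by
  classical
  -- V is continuous on D, so setting it to ⊤ off D makes it measurable. The change is confined to
  -- the frontier of the domain, which is null by convexity.
  set D := interior {x | V x < ⊤} with hD
  have hDc : Convex ℝ D := hV.convex_dom.interior
  have hlt : ∀ x ∈ D, V x < ⊤ := fun x hx => interior_subset (s := {x | V x < ⊤}) hx
  have hcoe : ∀ x ∈ D, ((V x).toReal : EReal) = V x := fun x hx =>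
    EReal.coe_toReal (hlt x hx).ne (hb x)
  have hcv : ConvexOn ℝ D fun x => (V x).toReal := by
    refine ⟨hDc, fun x hx y hy a b ha hb hab => ?_⟩
    have h1 := hV.le_coe ha hb hab (hcoe x hx).ge (hcoe y hy).ge
    rw [← hcoe _ (hDc hx hy ha hb hab)] at h1
    exact_mod_cast h1
  have hcont : ContinuousOn (fun x => (((V x).toReal : ℝ) : EReal)) D :=
    continuous_coe_real_ereal.comp_continuousOn (hcv.continuousOn isOpen_interior)
  refine ⟨D.piecewise (fun x => (((V x).toReal : ℝ) : EReal)) (fun _ => ⊤), ?_, ?_, ?_, ?_⟩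
  · intro x y a b ha hb' hab
    rcases ha.eq_or_lt with rfl | ha
    · have : b = 1 := by linarith
      subst this
      rw [zero_smul, one_smul, zero_add]; simp
    rcases hb'.eq_or_lt with rfl | hb'
    · have : a = 1 := by linarith
      subst this
      rw [zero_smul, one_smul, add_zero]; simp
    have nb : ∀ (c : ℝ) (_ : 0 < c) z,
        (c : EReal) * D.piecewise (fun x => (((V x).toReal : ℝ) : EReal)) (fun _ => ⊤) z ≠ ⊥ := by
      intro c hc z
      by_cases hz : z ∈ D
      · rw [Set.piecewise_eq_of_mem _ _ _ hz, ← EReal.coe_mul]; exact EReal.coe_ne_bot _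
      · rw [Set.piecewise_eq_of_notMem _ _ _ hz, EReal.coe_mul_top_of_pos hc]; simp
    by_cases hx : x ∈ D
    · by_cases hy : y ∈ D
      · rw [Set.piecewise_eq_of_mem _ _ _ hx, Set.piecewise_eq_of_mem _ _ _ hy,
          Set.piecewise_eq_of_mem _ _ _ (hDc hx hy ha.le hb'.le hab), hcoe x hx, hcoe y hy,
          hcoe _ (hDc hx hy ha.le hb'.le hab)]
        exact hV x y a b ha.le hb'.le hab
      · rw [Set.piecewise_eq_of_notMem _ _ _ hy, EReal.coe_mul_top_of_pos hb',
          EReal.add_top_of_ne_bot (nb a ha x)]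
        exact le_top
    · rw [Set.piecewise_eq_of_notMem _ _ _ hx, EReal.coe_mul_top_of_pos ha,
        EReal.top_add_of_ne_bot (nb b hb' y)]
      exact le_top
  · intro x
    by_cases hx : x ∈ D
    · rw [Set.piecewise_eq_of_mem _ _ _ hx]; exact EReal.coe_ne_bot _
    · rw [Set.piecewise_eq_of_notMem _ _ _ hx]; simp
  · exact hcont.measurable_piecewise continuousOn_const isOpen_interior.measurableSet
  · have hnull := hV.convex_dom.addHaar_frontier (volume : Measure (EuclideanSpace ℝ (Fin n)))
    filter_upwards [measure_eq_zero_iff_ae_notMem.1 hnull] with x hx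
    by_cases hxD : x ∈ D
    · rw [Set.piecewise_eq_of_mem _ _ _ hxD, hcoe x hxD]
    · rw [Set.piecewise_eq_of_notMem _ _ _ hxD]
      by_contra hne
      exact hx ⟨subset_closure (lt_top_iff_ne_top.2 hne), hxD⟩

/-! ### From a finite integral to linear growth. -/

/-- The homothety with centre z and ratio 1 - s ≥ 1/2 sends the ball inside C to a ball inside C of
radius at least r/2. -/
theorem Convex.ball_subset_of_mem {E : Type*} [NormedAddCommGroup E] [NormedSpace ℝ E] {C : Set E}
    (hC : Convex ℝ C) {y₀ z : E} {r s : ℝ} (hr : Metric.ball y₀ r ⊆ C) (hz : z ∈ C)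
    (hs0 : 0 ≤ s) (hs : s ≤ 1 / 2) : Metric.ball (y₀ + s • (z - y₀)) (r / 2) ⊆ C := by
  intro p hp
  have h1 : (0 : ℝ) < 1 - s := by linarith
  set q := (1 - s)⁻¹ • (p - s • z) with hq
  have hpq : p = (1 - s) • q + s • z := by
    rw [hq, smul_inv_smul₀ h1.ne']; abel
  have hqC : q ∈ C := by
    apply hr
    rw [Metric.mem_ball, dist_eq_norm] at hp ⊢
    have : p - (y₀ + s • (z - y₀)) = (1 - s) • (q - y₀) := by
      rw [hpq]; module
    rw [this, norm_smul, Real.norm_of_nonneg h1.le] at hp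
    have := norm_nonneg (q - y₀)
    nlinarith
  rw [hpq]
  exact hC hqC hz h1.le hs0 (by ring)

section SublevelSets

variable {y₀ : EuclideanSpace ℝ (Fin n)} {r : ℝ}

/-- A far point z of C would put a ball of radius r/2 around the midpoint of y₀ and z, whereas C has
little volume far from y₀. -/
theorem Convex.exists_subset_closedBall {C : Set (EuclideanSpace ℝ (Fin n))} (hC : Convex ℝ C)
    (hr0 : 0 < r) (hr : Metric.ball y₀ r ⊆ C) (hfin : volume C ≠ ⊤) :
    ∃ R, 0 < R ∧ C ⊆ Metric.closedBall y₀ R := by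
  have ht := tendsto_measure_iInter_atTop (μ := volume)
    (s := fun N : ℕ => C \ Metric.closedBall y₀ N)
    (fun N => (hC.nullMeasurableSet volume).diff Metric.isClosed_closedBall.nullMeasurableSet)
    (fun i j hij => Set.sdiff_subset_sdiff_right
      (Metric.closedBall_subset_closedBall (by exact_mod_cast hij)))
    ⟨0, ne_top_of_le_ne_top hfin (measure_mono Set.sdiff_subset)⟩
  have he : ⋂ N : ℕ, C \ Metric.closedBall y₀ N = ∅ := by
    ext x
    simp only [Set.mem_iInter, Set.mem_sdiff, Metric.mem_closedBall, not_le,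
      Set.mem_empty_iff_false, iff_false, not_forall, not_and, not_lt]
    obtain ⟨N, hN⟩ := exists_nat_ge (dist x y₀)
    exact ⟨N, fun _ => hN⟩
  rw [he, measure_empty] at ht
  have hpos : 0 < volume (Metric.ball (0 : EuclideanSpace ℝ (Fin n)) (r / 2)) :=
    Metric.measure_ball_pos _ _ (by positivity)
  obtain ⟨N, hN⟩ := (ht.eventually (gt_mem_nhds hpos)).exists
  -- Beyond this radius the midpoint is at distance more than N + r/2 from y₀, so its ball avoids
  -- the ball of radius N.
  refine ⟨2 * N + r, by positivity, fun z hz => ?_⟩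
  by_contra hz'
  rw [Metric.mem_closedBall, not_le] at hz'
  refine lt_irrefl _ (hN.trans_le ?_)
  rw [← Measure.addHaar_ball_center volume (y₀ + (1 / 2 : ℝ) • (z - y₀))]
  refine measure_mono fun p hp => ⟨Convex.ball_subset_of_mem hC hr hz (by norm_num) le_rfl hp, ?_⟩
  rw [Metric.mem_closedBall, not_le]
  rw [Metric.mem_ball] at hp
  have h1 : dist (y₀ + (1 / 2 : ℝ) • (z - y₀)) y₀ = 1 / 2 * dist z y₀ := by
    rw [dist_eq_norm, dist_eq_norm, add_sub_cancel_left, norm_smul]; norm_num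
  have h2 := dist_triangle (y₀ + (1 / 2 : ℝ) • (z - y₀)) p y₀
  rw [dist_comm _ p] at h2
  linarith

/-- The sets C k may all have infinite volume, so only their traces on a bounded annulus around the
limit set are compared. These traces decrease to ∅, while a far point of C k would leave a ball of
radius r/2 in the annulus. -/
theorem Convex.exists_subset_ball_of_antitone {C : ℕ → Set (EuclideanSpace ℝ (Fin n))}
    (hC : ∀ k, Convex ℝ (C k)) (hanti : Antitone C) (hr0 : 0 < r)
    (hr : ∀ k, Metric.ball y₀ r ⊆ C k) (hfin : volume (⋂ k, C k) ≠ ⊤) :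
    ∃ R, 0 < R ∧ ∀ᶠ k in Filter.atTop, C k ⊆ Metric.ball y₀ R := by
  obtain ⟨R, hR0, hR⟩ := Convex.exists_subset_closedBall (convex_iInter hC) hr0
    (Set.subset_iInter hr) hfin
  have ht := tendsto_measure_iInter_atTop (μ := volume)
    (s := fun k : ℕ => (C k \ Metric.closedBall y₀ R) ∩ Metric.closedBall y₀ (R + r))
    (fun N => (((hC N).nullMeasurableSet volume).diff
      Metric.isClosed_closedBall.nullMeasurableSet).inter
      Metric.isClosed_closedBall.nullMeasurableSet)
    (fun i j hij => Set.inter_subset_inter_left _ (Set.sdiff_subset_sdiff_left (hanti hij)))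
    ⟨0, ne_top_of_le_ne_top measure_closedBall_lt_top.ne (measure_mono Set.inter_subset_right)⟩
  have he : ⋂ k : ℕ, (C k \ Metric.closedBall y₀ R) ∩ Metric.closedBall y₀ (R + r) = ∅ := by
    refine Set.eq_empty_of_forall_notMem fun x hx => ?_
    rw [Set.mem_iInter] at hx
    exact (hx 0).1.2 (hR (Set.mem_iInter.2 fun k => (hx k).1.1))
  rw [he, measure_empty] at ht
  have hpos : 0 < volume (Metric.ball (0 : EuclideanSpace ℝ (Fin n)) (r / 2)) :=
    Metric.measure_ball_pos _ _ (by positivity)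
  refine ⟨2 * R + r, by positivity, ?_⟩
  filter_upwards [ht.eventually (gt_mem_nhds hpos)] with k hk z hz
  by_contra hz'
  rw [Metric.mem_ball, not_lt] at hz'
  refine lt_irrefl _ (hk.trans_le ?_)
  set D := dist z y₀ with hD
  have hD0 : 0 < D := by linarith
  -- The centre is placed at distance R + r/2, the middle of the annulus; D ≥ 2R + r gives s ≤ 1/2.
  set s := (R + r / 2) / D with hs
  have hsD : s * D = R + r / 2 := by rw [hs]; field_simp
  have hs0 : 0 ≤ s := by positivity
  have hs1 : s ≤ 1 / 2 := by rw [hs, div_le_iff₀ hD0]; linarith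
  rw [← Measure.addHaar_ball_center volume (y₀ + s • (z - y₀))]
  have h1 : dist (y₀ + s • (z - y₀)) y₀ = s * D := by
    rw [dist_eq_norm, hD, dist_eq_norm, add_sub_cancel_left, norm_smul, Real.norm_of_nonneg hs0]
  refine measure_mono fun p hp =>
    ⟨⟨Convex.ball_subset_of_mem (hC k) (hr k) hz hs0 hs1 hp, ?_⟩, ?_⟩
  · rw [Metric.mem_closedBall, not_le]
    rw [Metric.mem_ball] at hp
    have h2 := dist_triangle (y₀ + s • (z - y₀)) p y₀
    rw [dist_comm _ p] at h2
    linarith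
  · rw [Metric.mem_closedBall]
    rw [Metric.mem_ball] at hp
    have h2 := dist_triangle p (y₀ + s • (z - y₀)) y₀
    linarith

/-- A convex function which is larger outside a bounded set than on some ball
grows at least linearly. -/
theorem EConvex.exists_linear_le {U : EuclideanSpace ℝ (Fin n) → EReal} (hU : EConvex U)
    (hb : ∀ x, U x ≠ ⊥) {M ρ : ℝ} (hr0 : 0 < r) (hρ : 0 < ρ)
    (hM : ∀ y ∈ Metric.ball y₀ r, U y ≤ (M : EReal))
    (hbd : {y | U y ≤ ((M + 1 : ℝ) : EReal)} ⊆ Metric.ball y₀ ρ) :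
    ∃ c A : ℝ, 0 < c ∧ ∀ y, ((c * ‖y‖ + A : ℝ) : EReal) ≤ U y := by
  have hU0 : U y₀ ≤ (M : EReal) := hM y₀ (Metric.mem_ball_self hr0)
  obtain ⟨u₀, hu₀⟩ : ∃ u₀ : ℝ, U y₀ = (u₀ : EReal) :=
    ⟨(U y₀).toReal, (EReal.coe_toReal (hU0.trans_lt (EReal.coe_lt_top M)).ne (hb y₀)).symm⟩
  -- For y within ρ of y₀, the point y₀ - ε(y - y₀) stays in the small ball where U ≤ M. Convexity
  -- at y₀, between this point and y, then bounds U y from below by A₀.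
  set ε := r / (2 * ρ) with hε
  have hε0 : 0 < ε := by positivity
  set A₀ := ((1 + ε) * u₀ - M) / ε with hA₀
  refine ⟨1 / ρ, min M (A₀ - 1) - ‖y₀‖ / ρ, by positivity, fun y => ?_⟩
  by_cases hy : U y = ⊤
  · rw [hy]; exact le_top
  obtain ⟨u, hu⟩ : ∃ u : ℝ, U y = (u : EReal) :=
    ⟨(U y).toReal, (EReal.coe_toReal hy (hb y)).symm⟩
  rw [hu, EReal.coe_le_coe_iff]
  set D := ‖y - y₀‖ with hD
  have hnorm : ‖y‖ ≤ ‖y₀‖ + D := by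
    have := norm_add_le y₀ (y - y₀)
    rwa [add_sub_cancel] at this
  suffices h : D / ρ + min M (A₀ - 1) ≤ u by
    have : 1 / ρ * ‖y‖ ≤ ‖y₀‖ / ρ + D / ρ := by
      rw [← add_div, one_div_mul_eq_div]; gcongr
    linarith
  rcases lt_or_ge D ρ with hlt | hge
  · have h1 : D / ρ < 1 := (div_lt_one hρ).2 hlt
    have hy' : y₀ - ε • (y - y₀) ∈ Metric.ball y₀ r := by
      rw [Metric.mem_ball, dist_eq_norm, sub_sub_cancel_left, norm_neg, norm_smul,
        Real.norm_of_nonneg hε0.le]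
      calc ε * D ≤ ε * ρ := by gcongr
        _ = r / 2 := by rw [hε]; field_simp
        _ < r := by linarith
    have h2 := hU.le_coe (a := 1 / (1 + ε)) (b := ε / (1 + ε)) (by positivity) (by positivity)
      (by field_simp) (hM _ hy') hu.le
    have h3 : (1 / (1 + ε)) • (y₀ - ε • (y - y₀)) + (ε / (1 + ε)) • y = y₀ := by
      have h4 : (ε / (1 + ε)) = ε * (1 / (1 + ε)) := by ring
      have h5 : (1 / (1 + ε)) * (1 + ε) = 1 := by field_simp
      calc _ = ((1 / (1 + ε)) * (1 + ε)) • y₀ := by rw [h4]; module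
        _ = y₀ := by rw [h5, one_smul]
    rw [h3, hu₀, EReal.coe_le_coe_iff] at h2
    have h4 : (1 + ε) * u₀ ≤ M + ε * u := by
      have := mul_le_mul_of_nonneg_left h2 (by positivity : 0 ≤ 1 + ε)
      field_simp at this
      linarith
    have h5 : A₀ ≤ u := by
      rw [hA₀, div_le_iff₀ hε0]; linarith
    have := min_le_right M (A₀ - 1)
    linarith
  -- The point of the segment from y₀ to y at distance ρ has U > M + 1 while U y₀ ≤ M; convexity
  -- propagates this as slope at least 1/ρ.
  · have hD0 : 0 < D := hρ.trans_le hge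
    set l := ρ / D with hl
    have hl0 : 0 < l := by positivity
    have hl1 : l ≤ 1 := (div_le_one hD0).2 hge
    have hp : ¬ U ((1 - l) • y₀ + l • y) ≤ ((M + 1 : ℝ) : EReal) := by
      intro h
      have h1 := hbd h
      rw [Metric.mem_ball, dist_eq_norm] at h1
      have h2 : (1 - l) • y₀ + l • y - y₀ = l • (y - y₀) := by module
      rw [h2, norm_smul, Real.norm_of_nonneg hl0.le, ← hD, hl, div_mul_cancel₀ _ hD0.ne'] at h1
      exact lt_irrefl _ h1
    have h2 := (not_le.1 hp).trans_le
      (hU.le_coe (by linarith) hl0.le (by ring) hU0 hu.le)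
    rw [EReal.coe_lt_coe_iff] at h2
    have h3 : 1 / l < u - M := by
      rw [div_lt_iff₀ hl0]; linarith
    have h4 : 1 / l = D / ρ := by rw [hl, one_div_div]
    have := min_le_left M (A₀ - 1)
    linarith

end SublevelSets

theorem integrable_one_add_norm_mul_exp_neg {c : ℝ} (hc : 0 < c) :
    Integrable (fun y : EuclideanSpace ℝ (Fin n) => (1 + ‖y‖) * Real.exp (-(c * ‖y‖))) := by
  set N := Module.finrank ℝ (EuclideanSpace ℝ (Fin n)) with hN
  have h := integrable_one_add_norm (E := EuclideanSpace ℝ (Fin n)) (μ := volume)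
    (r := ((N + 1 : ℕ) : ℝ)) (by push_cast; linarith)
  refine (h.const_mul ((N + 2).factorial / c ^ (N + 2) * Real.exp c)).mono' (by fun_prop)
    (Filter.Eventually.of_forall fun y => ?_)
  rw [Real.norm_of_nonneg (by positivity), Real.rpow_neg (by positivity), Real.rpow_natCast]
  have hs : 0 < 1 + ‖y‖ := by positivity
  -- Of the N + 2 powers of 1 + ‖y‖ gained, one pays for the weight and N + 1 remain, enough for
  -- integrability in dimension N.
  have h1 := Real.pow_div_factorial_le_exp (c * (1 + ‖y‖)) (by positivity) (N + 2)
  rw [mul_pow, div_le_iff₀ (by positivity)] at h1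
  have h2 : Real.exp (c * (1 + ‖y‖)) = Real.exp c * Real.exp (c * ‖y‖) := by
    rw [← Real.exp_add]; congr 1; ring
  rw [h2] at h1
  rw [Real.exp_neg, ← div_eq_mul_inv, ← div_eq_mul_inv, div_le_div_iff₀ (by positivity)
    (by positivity)]
  have h3 : (1 + ‖y‖) * (1 + ‖y‖) ^ (N + 1) = (1 + ‖y‖) ^ (N + 2) := by ring
  rw [h3, div_mul_eq_mul_div, div_mul_eq_mul_div, le_div_iff₀ (by positivity)]
  linarith

theorem lintegral_one_add_norm_mul_exp_neg_lt_top {U : EuclideanSpace ℝ (Fin n) → EReal}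
    {c A : ℝ} (hc : 0 < c) (h : ∀ y, ((c * ‖y‖ + A : ℝ) : EReal) ≤ U y) :
    ∫⁻ y, ENNReal.ofReal (1 + ‖y‖) * EReal.exp (-U y) < ⊤ := by
  have hi := (integrable_one_add_norm_mul_exp_neg (n := n) hc).mul_const (Real.exp (-A))
  refine lt_of_le_of_lt (lintegral_mono fun y => ?_) hi.lintegral_lt_top
  have : EReal.exp (-U y) ≤ ENNReal.ofReal (Real.exp (-(c * ‖y‖)) * Real.exp (-A)) := by
    rw [← Real.exp_add, ← EReal.exp_coe, EReal.exp_le_exp_iff, ← neg_add, EReal.coe_neg,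
      EReal.neg_le_neg_iff]
    exact h y
  rw [mul_assoc, ENNReal.ofReal_mul (by positivity)]
  gcongr

/-- If a convex function `W` with `0 < ∫ e^{-W} < ∞` is the increasing limit of convex functions
`W k`, then `W k` eventually grows at least linearly. -/
theorem EConvex.eventually_exists_linear_le {W : ℕ → EuclideanSpace ℝ (Fin n) → EReal}
    (hW : ∀ k, EConvex (W k)) (hb : ∀ k x, W k x ≠ ⊥) (hm : ∀ k, Measurable (W k))
    (hmono : Monotone W) (hpos : ∫⁻ y, EReal.exp (-⨆ k, W k y) ≠ 0)
    (hfin : ∫⁻ y, EReal.exp (-⨆ k, W k y) ≠ ⊤) :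
    ∀ᶠ k in Filter.atTop, ∃ c A : ℝ, 0 < c ∧ ∀ y, ((c * ‖y‖ + A : ℝ) : EReal) ≤ W k y := by
  have hmS : Measurable fun y => ⨆ k, W k y := Measurable.iSup hm
  have hmE : Measurable fun y => EReal.exp (-⨆ k, W k y) := hmS.neg.ereal_exp
  have hlev : ∀ c : ℝ, {y | ⨆ k, W k y ≤ (c : EReal)} = ⋂ k, {y | W k y ≤ (c : EReal)} := by
    intro c; ext y; simp
  obtain ⟨M, hM⟩ : ∃ M : ℕ, volume {y | ⨆ k, W k y ≤ ((M : ℝ) : EReal)} ≠ 0 := by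
    by_contra! hcon
    apply hpos
    rw [lintegral_eq_zero_iff hmE]
    have : ∀ M : ℕ, ∀ᵐ y, ¬ ⨆ k, W k y ≤ ((M : ℝ) : EReal) := fun M =>
      measure_eq_zero_iff_ae_notMem.1 (hcon M)
    filter_upwards [ae_all_iff.2 this] with y hy
    have : ⨆ k, W k y = ⊤ := by
      rw [EReal.eq_top_iff_forall_lt]
      intro x
      obtain ⟨N, hN⟩ := exists_nat_ge x
      exact lt_of_le_of_lt (EReal.coe_le_coe_iff.2 hN) (not_le.1 (hy N))
    simp [this]
  rw [hlev] at hM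
  have hcvx : Convex ℝ (⋂ k, {y | W k y ≤ ((M : ℝ) : EReal)}) :=
    convex_iInter fun k => (hW k).convex_sublevel _
  -- A convex set of positive volume has interior, since its frontier is null. The resulting ball
  -- serves every k.
  obtain ⟨y₀, hy₀⟩ : (interior (⋂ k, {y | W k y ≤ ((M : ℝ) : EReal)})).Nonempty := by
    by_contra hne
    rw [Set.not_nonempty_iff_eq_empty] at hne
    apply hM
    refine measure_mono_null ?_ (hcvx.addHaar_frontier volume)
    intro y hy
    exact ⟨subset_closure hy, by rw [hne]; exact Set.notMem_empty y⟩
  obtain ⟨r, hr0, hr⟩ := Metric.isOpen_iff.1 isOpen_interior y₀ hy₀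
  have hball : ∀ k, ∀ y ∈ Metric.ball y₀ r, W k y ≤ ((M : ℝ) : EReal) := fun k y hy =>
    Set.mem_iInter.1 (interior_subset (hr hy)) k
  -- Markov's inequality for e^{-sup W}.
  have hvol : volume (⋂ k, {y | W k y ≤ (((M : ℝ) + 1 : ℝ) : EReal)}) ≠ ⊤ := by
    rw [← hlev]
    intro htop
    apply hfin
    have h1 := mul_meas_ge_le_lintegral₀ (μ := volume) hmE.aemeasurable
      (EReal.exp (-(((M : ℝ) + 1 : ℝ) : EReal)))
    have h2 : {y | EReal.exp (-(((M : ℝ) + 1 : ℝ) : EReal)) ≤ EReal.exp (-⨆ k, W k y)}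
        = {y | ⨆ k, W k y ≤ (((M : ℝ) + 1 : ℝ) : EReal)} := by
      ext y
      simp only [Set.mem_ofPred_eq, EReal.exp_le_exp_iff, EReal.neg_le_neg_iff]
    have h3 : EReal.exp (-(((M : ℝ) + 1 : ℝ) : EReal)) ≠ 0 := by
      rw [← EReal.coe_neg, EReal.exp_coe]
      simp [Real.exp_pos]
    refine top_le_iff.1 (le_trans ?_ h1)
    rw [h2, htop, ENNReal.mul_top h3]
  obtain ⟨R, hR0, hR⟩ := Convex.exists_subset_ball_of_antitone
    (C := fun k => {y | W k y ≤ (((M : ℝ) + 1 : ℝ) : EReal)})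
    (fun k => (hW k).convex_sublevel _) (fun i j hij y hy => (hmono hij y).trans hy) hr0
    (fun k y hy => (hball k y hy).trans (EReal.coe_le_coe_iff.2 (by linarith))) hvol
  filter_upwards [hR] with k hk
  exact (hW k).exists_linear_le (hb k) hr0 hR0 (hball k) hk

/-! ### Legendre transforms of restrictions to balls. -/

/-- The Legendre transform of the restriction of `f` to the ball of radius `k`. -/
noncomputable def ballConj (f : EuclideanSpace ℝ (Fin n) → EReal) (k : ℕ)
    (y : EuclideanSpace ℝ (Fin n)) : EReal :=
  ⨆ x ∈ Metric.closedBall (0 : EuclideanSpace ℝ (Fin n)) k, (((inner ℝ x y : ℝ) : EReal) - f x)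

theorem ballConj_mono (f : EuclideanSpace ℝ (Fin n) → EReal) : Monotone (ballConj f) :=
  fun _ _ hij _ => biSup_mono fun _ hx =>
    Metric.closedBall_subset_closedBall (by exact_mod_cast hij) hx

theorem iSup_ballConj (f : EuclideanSpace ℝ (Fin n) → EReal) (y : EuclideanSpace ℝ (Fin n)) :
    ⨆ k, ballConj f k y = conj f y := by
  apply le_antisymm
  · exact iSup_le fun k => iSup₂_le fun x _ =>
      le_iSup (fun x => (((inner ℝ x y : ℝ) : EReal) - f x)) x
  · refine iSup_le fun x => ?_
    obtain ⟨k, hk⟩ := exists_nat_ge ‖x‖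
    exact (le_iSup₂_of_le (f := fun x (_ : x ∈ Metric.closedBall 0 (k : ℝ)) =>
      (((inner ℝ x y : ℝ) : EReal) - f x)) x (by simpa using hk) le_rfl).trans
      (le_iSup (fun k => ballConj f k y) k)

/-- Lower semicontinuity and compactness of the ball turn the supremum into a finite maximum, which
is the source of both fields of `IsBallConj`. -/
theorem exists_ballConj_eq {f : EuclideanSpace ℝ (Fin n) → EReal} (hb : ∀ x, f x ≠ ⊥)
    (hlsc : LowerSemicontinuous f) {k : ℕ}
    (hk : ∃ x ∈ Metric.closedBall (0 : EuclideanSpace ℝ (Fin n)) k, f x < ⊤)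
    (y : EuclideanSpace ℝ (Fin n)) :
    ∃ x ∈ Metric.closedBall (0 : EuclideanSpace ℝ (Fin n)) k, f x < ⊤ ∧
      ballConj f k y = ((inner ℝ x y - (f x).toReal : ℝ) : EReal) := by
  obtain ⟨x₀, hx₀, hfx₀⟩ := hk
  have hl : LowerSemicontinuous fun x => f x + ((-inner ℝ x y : ℝ) : EReal) := by
    refine hlsc.add' ?_ fun x => EReal.continuousAt_add (Or.inr (EReal.coe_ne_bot _))
      (Or.inl (hb x))
    exact (continuous_coe_real_ereal.comp (by fun_prop)).lowerSemicontinuous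
  obtain ⟨x, hx, hmin⟩ := (hl.lowerSemicontinuousOn _).exists_isMinOn ⟨x₀, hx₀⟩
    (isCompact_closedBall (0 : EuclideanSpace ℝ (Fin n)) (k : ℝ))
  have key : ∀ x' ∈ Metric.closedBall (0 : EuclideanSpace ℝ (Fin n)) (k : ℝ),
      f x + ((-inner ℝ x y : ℝ) : EReal) ≤ f x' + ((-inner ℝ x' y : ℝ) : EReal) :=
    fun x' hx' => hmin hx'
  have hfx : f x < ⊤ := by
    by_contra h
    have htop : f x = ⊤ := not_lt_top_iff.1 h
    have := key x₀ hx₀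
    rw [htop, EReal.top_add_coe, top_le_iff] at this
    exact (EReal.add_lt_top hfx₀.ne (EReal.coe_ne_top _)).ne this
  have hreal : f x = (((f x).toReal : ℝ) : EReal) := (EReal.coe_toReal hfx.ne (hb x)).symm
  refine ⟨x, hx, hfx, le_antisymm (iSup₂_le fun x' hx' => ?_) ?_⟩
  · by_cases htop : f x' = ⊤
    · rw [htop, EReal.sub_top]; exact bot_le
    have hreal' : f x' = (((f x').toReal : ℝ) : EReal) := (EReal.coe_toReal htop (hb x')).symm
    have := key x' hx'
    rw [hreal, hreal', ← EReal.coe_add, ← EReal.coe_add, EReal.coe_le_coe_iff] at this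
    rw [hreal', ← EReal.coe_sub, EReal.coe_le_coe_iff]
    linarith
  · refine le_iSup₂_of_le x hx ?_
    conv_rhs => rw [hreal]
    exact le_rfl

/-- A real-valued function together with the properties of the Legendre transform of a function
restricted to a ball. -/
structure IsBallConj (f : EuclideanSpace ℝ (Fin n) → EReal) (k : ℕ)
    (φ : EuclideanSpace ℝ (Fin n) → ℝ) : Prop where
  inner_sub_le : ∀ x ∈ Metric.closedBall (0 : EuclideanSpace ℝ (Fin n)) k, f x < ⊤ →
    ∀ y, inner ℝ x y - (f x).toReal ≤ φ y
  exists_eq : ∀ y, ∃ x ∈ Metric.closedBall (0 : EuclideanSpace ℝ (Fin n)) k, f x < ⊤ ∧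
    φ y = inner ℝ x y - (f x).toReal

theorem isBallConj_toReal {f : EuclideanSpace ℝ (Fin n) → EReal} (hb : ∀ x, f x ≠ ⊥)
    (hlsc : LowerSemicontinuous f) {k : ℕ}
    (hk : ∃ x ∈ Metric.closedBall (0 : EuclideanSpace ℝ (Fin n)) k, f x < ⊤) :
    IsBallConj f k (fun y => (ballConj f k y).toReal) ∧
      ∀ y, (((ballConj f k y).toReal : ℝ) : EReal) = ballConj f k y := by
  have hcoe : ∀ y, (((ballConj f k y).toReal : ℝ) : EReal) = ballConj f k y := by
    intro y
    obtain ⟨x, -, -, h⟩ := exists_ballConj_eq hb hlsc hk y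
    rw [h, EReal.toReal_coe]
  refine ⟨⟨fun x hx hfx y => ?_, fun y => ?_⟩, hcoe⟩
  · rw [← EReal.coe_le_coe_iff, hcoe, EReal.coe_sub, EReal.coe_toReal hfx.ne (hb x)]
    exact le_iSup₂_of_le (f := fun x (_ : x ∈ Metric.closedBall 0 (k : ℝ)) =>
      (((inner ℝ x y : ℝ) : EReal) - f x)) x hx le_rfl
  · obtain ⟨x, hx, hfx, h⟩ := exists_ballConj_eq hb hlsc hk y
    exact ⟨x, hx, hfx, by rw [h, EReal.toReal_coe]⟩

namespace IsBallConj

variable {f : EuclideanSpace ℝ (Fin n) → EReal} {k : ℕ} {φ : EuclideanSpace ℝ (Fin n) → ℝ}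

theorem eConvex (h : IsBallConj f k φ) : EConvex fun y => (φ y : EReal) := by
  intro y z a b ha hb hab
  obtain ⟨x, hx, hfx, hxy⟩ := h.exists_eq (a • y + b • z)
  rw [← EReal.coe_mul, ← EReal.coe_mul, ← EReal.coe_add, EReal.coe_le_coe_iff, hxy,
    inner_add_right, real_inner_smul_right, real_inner_smul_right]
  have h1 := mul_le_mul_of_nonneg_left (h.inner_sub_le x hx hfx y) ha
  have h2 := mul_le_mul_of_nonneg_left (h.inner_sub_le x hx hfx z) hb
  have h3 : (f x).toReal = a * (f x).toReal + b * (f x).toReal := by rw [← add_mul, hab, one_mul]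
  linarith

theorem sub_le (h : IsBallConj f k φ) (y z : EuclideanSpace ℝ (Fin n)) :
    φ y - φ z ≤ k * ‖y - z‖ := by
  obtain ⟨x, hx, hfx, hxy⟩ := h.exists_eq y
  have h1 := h.inner_sub_le x hx hfx z
  have h2 := real_inner_le_norm x (y - z)
  rw [inner_sub_right] at h2
  have h3 : ‖x‖ * ‖y - z‖ ≤ k * ‖y - z‖ := by
    gcongr; simpa using hx
  linarith

theorem lipschitzWith (h : IsBallConj f k φ) : LipschitzWith k φ := by
  refine LipschitzWith.of_dist_le_mul fun y z => ?_
  rw [Real.dist_eq, dist_eq_norm, abs_sub_le_iff]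
  refine ⟨h.sub_le y z, ?_⟩
  rw [norm_sub_rev]
  exact h.sub_le z y

theorem le_add (h : IsBallConj f k φ) (y : EuclideanSpace ℝ (Fin n)) :
    φ y ≤ φ 0 + k * ‖y‖ := by
  have := h.sub_le y 0
  rw [sub_zero] at this
  linarith

theorem sub_le_self (h : IsBallConj f k φ) (y : EuclideanSpace ℝ (Fin n)) :
    φ 0 - k * ‖y‖ ≤ φ y := by
  have := h.sub_le 0 y
  rw [zero_sub, norm_neg] at this
  linarith

/-- If x attains the maximum defining φ y, then φ - ⟨x, ·⟩ is minimal at y, so x is the gradient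
there. -/
theorem gradient_spec (h : IsBallConj f k φ) {y : EuclideanSpace ℝ (Fin n)}
    (hy : DifferentiableAt ℝ φ y) :
    gradient φ y ∈ Metric.closedBall (0 : EuclideanSpace ℝ (Fin n)) k ∧ f (gradient φ y) < ⊤ ∧
      (f (gradient φ y)).toReal = inner ℝ (gradient φ y) y - φ y := by
  obtain ⟨x, hx, hfx, hxy⟩ := h.exists_eq y
  have hmin : IsLocalMin (fun z => φ z - innerSL ℝ x z) y := by
    refine Filter.Eventually.of_forall fun z => ?_
    have := h.inner_sub_le x hx hfx z
    simp only [innerSL_apply_apply]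
    linarith
  have hd : HasFDerivAt (fun z => φ z - innerSL ℝ x z) (fderiv ℝ φ y - innerSL ℝ x) y :=
    hy.hasFDerivAt.sub (innerSL ℝ x).hasFDerivAt
  have h0 : fderiv ℝ φ y = innerSL ℝ x := sub_eq_zero.1 (hmin.hasFDerivAt_eq_zero hd)
  have hg : gradient φ y = x := by
    rw [gradient, h0, LinearIsometryEquiv.symm_apply_eq]
    rfl
  rw [hg]
  exact ⟨hx, hfx, by linarith⟩

theorem ae_differentiableAt (h : IsBallConj f k φ) : ∀ᵐ y, DifferentiableAt ℝ φ y :=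
  h.lipschitzWith.ae_differentiableAt

end IsBallConj

theorem measurable_gradient (φ : EuclideanSpace ℝ (Fin n) → ℝ) : Measurable (gradient φ) :=
  (InnerProductSpace.toDual ℝ (EuclideanSpace ℝ (Fin n))).symm.continuous.measurable.comp
    (measurable_fderiv ℝ φ)

theorem gradient_comp_isometry {φ : EuclideanSpace ℝ (Fin n) → ℝ}
    (S : EuclideanSpace ℝ (Fin n) ≃ₗᵢ[ℝ] EuclideanSpace ℝ (Fin n)) (h : ∀ y, φ (S y) = φ y)
    (y : EuclideanSpace ℝ (Fin n)) : gradient φ (S y) = S (gradient φ y) := by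
  have h1 : fderiv ℝ φ y = (fderiv ℝ φ (S y)).comp (S.toContinuousLinearEquiv :
      EuclideanSpace ℝ (Fin n) →L[ℝ] EuclideanSpace ℝ (Fin n)) := by
    rw [← S.coe_toContinuousLinearEquiv, ← ContinuousLinearEquiv.comp_right_fderiv]
    congr 1
    ext z
    exact (h z).symm
  refine ext_inner_right ℝ fun v => ?_
  obtain ⟨v, rfl⟩ := S.surjective v
  rw [S.inner_map_map]
  simp only [gradient, InnerProductSpace.toDual_symm_apply]
  rw [h1]
  rfl

theorem measurable_conj {g : EuclideanSpace ℝ (Fin n) → EReal} (hb : ∀ x, g x ≠ ⊥) :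
    Measurable (conj g) := by
  refine LowerSemicontinuous.measurable (lowerSemicontinuous_iSup fun x => ?_)
  by_cases htop : g x = ⊤
  · simp only [htop, EReal.sub_top]
    exact lowerSemicontinuous_const
  · have hreal : g x = (((g x).toReal : ℝ) : EReal) := (EReal.coe_toReal htop (hb x)).symm
    rw [hreal]
    simp only [← EReal.coe_sub]
    exact (continuous_coe_real_ereal.comp (by fun_prop)).lowerSemicontinuous

theorem ballConj_comp_isometry {f : EuclideanSpace ℝ (Fin n) → EReal}
    (S : EuclideanSpace ℝ (Fin n) ≃ₗᵢ[ℝ] EuclideanSpace ℝ (Fin n)) (h : ∀ x, f (S x) = f x)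
    (k : ℕ) (y : EuclideanSpace ℝ (Fin n)) : ballConj f k (S y) = ballConj f k y := by
  unfold ballConj
  rw [← S.surjective.iSup_comp]
  simp [h]

/-! ### Linearizing Prékopa–Leindler as one weight tends to zero. -/

/-- Both sides equal 1 at t = 0, so their difference quotients compare and tend to a and ∫w. The
upper bound on w gives the dominating function |w|e^{C'}. -/
theorem le_integral_of_exp_le {α : Type*} [MeasurableSpace α] {η : Measure α}
    [IsProbabilityMeasure η] {w : α → ℝ} (hw : Integrable w η) {C a : ℝ}
    (hC : ∀ᵐ y ∂η, w y ≤ C)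
    (h : ∀ t : ℝ, 0 < t → t < 1 → ENNReal.ofReal (Real.exp (t * a)) ≤
      ∫⁻ y, ENNReal.ofReal (Real.exp (t * w y)) ∂η) : a ≤ ∫ y, w y ∂η := by
  set C' := max C 0 with hC'
  have hCC : ∀ᵐ y ∂η, w y ≤ C' := hC.mono fun y hy => hy.trans (le_max_left _ _)
  have hC0 : 0 ≤ C' := le_max_right _ _
  set s : ℕ → ℝ := fun k => 1 / ((k : ℝ) + 2) with hs
  have hs0 : ∀ k, 0 < s k := fun k => by positivity
  have hs1 : ∀ k, s k < 1 := fun k => by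
    rw [hs]; simp only; rw [div_lt_one (by positivity)]
    have : (0 : ℝ) ≤ k := Nat.cast_nonneg k
    linarith
  have hst : Filter.Tendsto s Filter.atTop (nhdsWithin 0 {0}ᶜ) := by
    rw [tendsto_nhdsWithin_iff]
    refine ⟨?_, Filter.Eventually.of_forall fun k => (hs0 k).ne'⟩
    have h1 : Filter.Tendsto (fun k : ℕ => (k : ℝ) + 2) Filter.atTop Filter.atTop :=
      Filter.tendsto_atTop_add_const_right _ _ tendsto_natCast_atTop_atTop
    simp only [hs, one_div]
    exact h1.inv_tendsto_atTop
  have hlim : ∀ b : ℝ, Filter.Tendsto (fun k => (Real.exp (s k * b) - 1) / s k) Filter.atTop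
      (nhds b) := by
    intro b
    have hd : HasDerivAt (fun t : ℝ => Real.exp (t * b)) b 0 := by
      have := ((hasDerivAt_id (0 : ℝ)).mul_const b).exp
      simpa using this
    have := (hasDerivAt_iff_tendsto_slope.1 hd).comp hst
    refine this.congr fun k => ?_
    simp [slope_def_field]
  have hbound : ∀ k, ∀ᵐ y ∂η, ‖(Real.exp (s k * w y) - 1) / s k‖ ≤ |w y| * Real.exp C' := by
    intro k
    filter_upwards [hCC] with y hy
    rw [Real.norm_eq_abs, abs_div, abs_of_pos (hs0 k), div_le_iff₀ (hs0 k)]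
    have hexp : 1 ≤ Real.exp C' := Real.one_le_exp hC0
    rcases le_total 0 (w y) with h0 | h0
    · have h1 : 0 ≤ s k * w y := mul_nonneg (hs0 k).le h0
      rw [abs_of_nonneg (by linarith [Real.one_le_exp h1]), abs_of_nonneg h0]
      have h2 : Real.exp (s k * w y) * (1 - s k * w y) ≤ 1 := by
        have := Real.one_sub_le_exp_neg (s k * w y)
        calc _ ≤ Real.exp (s k * w y) * Real.exp (-(s k * w y)) := by gcongr
          _ = 1 := by rw [← Real.exp_add]; simp
      have h3 : Real.exp (s k * w y) ≤ Real.exp C' := by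
        refine Real.exp_le_exp.2 ?_
        nlinarith [hs1 k, hs0 k]
      have h4 : s k * w y * Real.exp (s k * w y) ≤ s k * w y * Real.exp C' := by gcongr
      linarith
    · have h1 : s k * w y ≤ 0 := mul_nonpos_of_nonneg_of_nonpos (hs0 k).le h0
      rw [abs_of_nonpos (by linarith [Real.exp_le_one_iff.2 h1]), abs_of_nonpos h0]
      have h2 := Real.add_one_le_exp (s k * w y)
      have h3 : -w y * s k * 1 ≤ -w y * s k * Real.exp C' := by
        gcongr
        have := hs0 k
        nlinarith
      linarith
  have hmeas : ∀ t : ℝ, AEStronglyMeasurable (fun y => Real.exp (t * w y)) η := fun t =>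
    Real.continuous_exp.comp_aestronglyMeasurable (hw.1.const_mul t)
  have hI := tendsto_integral_of_dominated_convergence (fun y => |w y| * Real.exp C')
    (fun k => by
      simp only [div_eq_mul_inv]
      exact ((hmeas (s k)).sub aestronglyMeasurable_const).mul_const (s k)⁻¹)
    (hw.abs.mul_const _) hbound (Filter.Eventually.of_forall fun y => hlim (w y))
  refine le_of_tendsto_of_tendsto (hlim a) hI (Filter.Eventually.of_forall fun k => ?_)
  have hint : Integrable (fun y => Real.exp (s k * w y)) η := by
    refine Integrable.mono' (integrable_const (Real.exp C')) (hmeas _) ?_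
    filter_upwards [hCC] with y hy
    rw [Real.norm_of_nonneg (Real.exp_pos _).le]
    refine Real.exp_le_exp.2 ?_
    nlinarith [hs1 k, hs0 k]
  have h1 := h (s k) (hs0 k) (hs1 k)
  rw [← ofReal_integral_eq_lintegral_ofReal hint
    (Filter.Eventually.of_forall fun y => (Real.exp_pos _).le),
    ENNReal.ofReal_le_ofReal_iff (integral_nonneg fun y => (Real.exp_pos _).le)] at h1
  beta_reduce
  rw [integral_div, integral_sub hint (integrable_const _)]
  simp only [integral_const, probReal_univ, smul_eq_mul, mul_one]
  have := hs0 k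
  gcongr

namespace IsBallConj

variable {f g : EuclideanSpace ℝ (Fin n) → EReal} {k : ℕ} {φ : EuclideanSpace ℝ (Fin n) → ℝ}
  {V : EuclideanSpace ℝ (Fin n) → EReal}

/-- The difference between a truncation of `g` and `f`, at the point `∇φ y`. -/
noncomputable def truncDiff (φ : EuclideanSpace ℝ (Fin n) → ℝ)
    (g : EuclideanSpace ℝ (Fin n) → EReal) (c : ℝ) (y : EuclideanSpace ℝ (Fin n)) : ℝ :=
  (min (g (gradient φ y)) c).toReal - (inner ℝ (gradient φ y) y - φ y)

theorem measurable_truncDiff (h : IsBallConj f k φ) (hg : Measurable g) (c : ℝ) :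
    Measurable (truncDiff φ g c) := by
  have hφ := h.lipschitzWith.continuous.measurable
  have hT := measurable_gradient φ
  exact (((hg.comp hT).min measurable_const).ereal_toReal).sub ((hT.inner measurable_id).sub hφ)

/-- With y = a y₀ + t y₁ and x = ∇φ(y), add a times φ(y₀) ≥ ⟨x, y₀⟩ - f(x) to t times g*(y₁) ≥ ⟨x,
y₁⟩ - g(x), and use f(x) = ⟨x, y⟩ - φ(y). By `hc` the second inequality survives replacing g by
min(g, c). -/
theorem prekopaLeindler_truncDiff_pointwise (h : IsBallConj f k φ) (hV : EConvex V)
    (hVb : ∀ x, V x ≠ ⊥) (hgb : ∀ x, g x ≠ ⊥) {R c : ℝ}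
    (hc : ∀ x ∈ Metric.closedBall (0 : EuclideanSpace ℝ (Fin n)) k,
      ∀ y ∈ Metric.closedBall (0 : EuclideanSpace ℝ (Fin n)) R,
        ((inner ℝ x y - c : ℝ) : EReal) ≤ conj g y)
    {a t : ℝ} (ha : 0 < a) (ht : 0 < t) (hat : a + t = 1) (y₀ y₁ : EuclideanSpace ℝ (Fin n))
    (hd : DifferentiableAt ℝ φ (a • y₀ + t • y₁)) :
    EReal.exp (-((φ y₀ : EReal) + V y₀)) ^ a *
      (Metric.closedBall 0 R).indicator (fun y => EReal.exp (-(conj g y + V y))) y₁ ^ t ≤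
    EReal.exp (((t * truncDiff φ g c (a • y₀ + t • y₁) - φ (a • y₀ + t • y₁) : ℝ) : EReal) -
      V (a • y₀ + t • y₁)) := by
  by_cases hy₁ : y₁ ∈ Metric.closedBall (0 : EuclideanSpace ℝ (Fin n)) R
  swap
  · rw [Set.indicator_of_notMem hy₁, ENNReal.zero_rpow_of_pos ht, mul_zero]; exact zero_le
  rw [Set.indicator_of_mem hy₁]
  by_cases hV₀ : V y₀ = ⊤
  · rw [hV₀, EReal.coe_add_top, EReal.neg_top, EReal.exp_bot, ENNReal.zero_rpow_of_pos ha,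
      zero_mul]
    exact zero_le
  have hcb : conj g y₁ ≠ ⊥ := by
    intro hbot
    have := hc 0 (by simp) y₁ hy₁
    rw [hbot, le_bot_iff] at this
    exact EReal.coe_ne_bot _ this
  by_cases hV₁ : V y₁ = ⊤
  · rw [hV₁, EReal.add_top_of_ne_bot hcb, EReal.neg_top, EReal.exp_bot,
      ENNReal.zero_rpow_of_pos ht, mul_zero]
    exact zero_le
  by_cases hc₁ : conj g y₁ = ⊤
  · rw [hc₁, EReal.top_add_of_ne_bot (hVb y₁), EReal.neg_top, EReal.exp_bot,
      ENNReal.zero_rpow_of_pos ht, mul_zero]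
    exact zero_le
  obtain ⟨v₀, hv₀⟩ : ∃ v : ℝ, V y₀ = v := ⟨_, (EReal.coe_toReal hV₀ (hVb y₀)).symm⟩
  obtain ⟨v₁, hv₁⟩ : ∃ v : ℝ, V y₁ = v := ⟨_, (EReal.coe_toReal hV₁ (hVb y₁)).symm⟩
  obtain ⟨γ, hγ⟩ : ∃ v : ℝ, conj g y₁ = v := ⟨_, (EReal.coe_toReal hc₁ hcb).symm⟩
  set y := a • y₀ + t • y₁ with hy
  have hVy : V y ≤ ((a * v₀ + t * v₁ : ℝ) : EReal) := hV.le_coe ha.le ht.le hat hv₀.le hv₁.le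
  obtain ⟨v, hv⟩ : ∃ v : ℝ, V y = v :=
    ⟨_, (EReal.coe_toReal (hVy.trans_lt (EReal.coe_lt_top _)).ne (hVb y)).symm⟩
  rw [hv, EReal.coe_le_coe_iff] at hVy
  obtain ⟨hx, hfx, hfe⟩ := h.gradient_spec hd
  set x := gradient φ y with hxdef
  have hu : ((inner ℝ x y₁ - γ : ℝ) : EReal) ≤ min (g x) c := by
    refine le_min ?_ ?_
    · have h1 : ((inner ℝ x y₁ : ℝ) : EReal) - g x ≤ γ := by
        rw [← hγ]; exact le_iSup (fun x => (((inner ℝ x y₁ : ℝ) : EReal) - g x)) x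
      by_cases hgx : g x = ⊤
      · rw [hgx]; exact le_top
      obtain ⟨q, hq⟩ : ∃ v : ℝ, g x = v := ⟨_, (EReal.coe_toReal hgx (hgb x)).symm⟩
      rw [hq, ← EReal.coe_sub, EReal.coe_le_coe_iff] at h1
      rw [hq, EReal.coe_le_coe_iff]
      linarith
    · have h1 := hc x hx y₁ hy₁
      rw [hγ, EReal.coe_le_coe_iff] at h1
      rw [EReal.coe_le_coe_iff]
      linarith
  obtain ⟨u, hu'⟩ : ∃ u : ℝ, min (g x) (c : EReal) = u := by
    refine ⟨_, (EReal.coe_toReal ((min_le_right _ _).trans_lt (EReal.coe_lt_top c)).ne ?_).symm⟩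
    exact ((EReal.bot_lt_coe _).trans_le hu).ne'
  have hw : truncDiff φ g c y = u - (inner ℝ x y - φ y) := by
    rw [truncDiff, ← hxdef, hu', EReal.toReal_coe]
  rw [hu', EReal.coe_le_coe_iff] at hu
  have h0 := h.inner_sub_le x hx hfx y₀
  rw [hfe] at h0
  have hin : (inner ℝ x y : ℝ) = a * inner ℝ x y₀ + t * inner ℝ x y₁ := by
    rw [hy, inner_add_right, real_inner_smul_right, real_inner_smul_right]
  rw [hv₀, hv₁, hv, hγ, ← ENNReal.log_le_log_iff, ENNReal.log_mul_add, ENNReal.log_rpow,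
    ENNReal.log_rpow, EReal.log_exp, EReal.log_exp, EReal.log_exp]
  have e : ((a : EReal) * -((φ y₀ : EReal) + v₀) + (t : EReal) * -((γ : EReal) + v₁)) =
      ((a * -(φ y₀ + v₀) + t * -(γ + v₁) : ℝ) : EReal) := by
    push_cast; rfl
  rw [e, ← EReal.coe_sub, EReal.coe_le_coe_iff, hw]
  have h1 := mul_le_mul_of_nonneg_left h0 ha.le
  have h2 := mul_le_mul_of_nonneg_left hu ht.le
  have h3 : a = 1 - t := by linarith
  subst h3
  nlinarith

theorem prekopaLeindler_truncDiff (h : IsBallConj f k φ) (hV : EConvex V)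
    (hVb : ∀ x, V x ≠ ⊥) (hVm : Measurable V) (hgb : ∀ x, g x ≠ ⊥)
    (hgm : Measurable g) {R c : ℝ}
    (hc : ∀ x ∈ Metric.closedBall (0 : EuclideanSpace ℝ (Fin n)) k,
      ∀ y ∈ Metric.closedBall (0 : EuclideanSpace ℝ (Fin n)) R,
        ((inner ℝ x y - c : ℝ) : EReal) ≤ conj g y)
    {a t : ℝ} (ha : 0 < a) (ht : 0 < t) (hat : a + t = 1) :
    (∫⁻ y, EReal.exp (-((φ y : EReal) + V y))) ^ a *
      (∫⁻ y in Metric.closedBall 0 R, EReal.exp (-(conj g y + V y))) ^ t ≤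
    ∫⁻ y, ENNReal.ofReal (Real.exp (t * truncDiff φ g c y)) *
      EReal.exp (-((φ y : EReal) + V y)) := by
  classical
  have hφ : Measurable fun y => (φ y : EReal) :=
    measurable_coe_real_ereal.comp h.lipschitzWith.continuous.measurable
  have hw := h.measurable_truncDiff hgm c
  have hD : MeasurableSet {y | DifferentiableAt ℝ φ y} := measurableSet_of_differentiableAt ℝ φ
  -- The value ⊤ on the null set where φ is not differentiable makes the pointwise hypothesis hold
  -- everywhere without changing the integral.
  set w : EuclideanSpace ℝ (Fin n) → ℝ≥0∞ := fun y => if DifferentiableAt ℝ φ y then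
    EReal.exp (((t * truncDiff φ g c y - φ y : ℝ) : EReal) - V y) else ⊤ with hwdef
  have hm1 : Measurable fun y => EReal.exp (-((φ y : EReal) + V y)) := (hφ.add hVm).neg.ereal_exp
  have hm2 : Measurable fun y => EReal.exp (-(conj g y + V y)) :=
    ((measurable_conj hgb).add hVm).neg.ereal_exp
  have hm3 : Measurable fun y => EReal.exp (((t * truncDiff φ g c y - φ y : ℝ) : EReal) - V y) :=
    ((measurable_coe_real_ereal.comp ((hw.const_mul t).sub
      h.lipschitzWith.continuous.measurable)).sub hVm).ereal_exp
  rw [← lintegral_indicator Metric.isClosed_closedBall.measurableSet]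
  refine (prekopaLeindler ha ht hat hm1 (hm2.indicator Metric.isClosed_closedBall.measurableSet)
    (w := w) (Measurable.ite hD hm3 measurable_const) fun y₀ y₁ => ?_).trans_eq ?_
  · simp only [hwdef]
    split_ifs with hd
    · exact h.prekopaLeindler_truncDiff_pointwise hV hVb hgb hc ha ht hat y₀ y₁ hd
    · exact le_top
  · refine lintegral_congr_ae ?_
    filter_upwards [h.ae_differentiableAt] with y hy
    simp only [hwdef, if_pos hy]
    rw [← EReal.exp_coe, ← EReal.exp_add]
    congr 1
    by_cases hVt : V y = ⊤
    · simp [hVt]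
    · obtain ⟨v, hv⟩ : ∃ v : ℝ, V y = v := ⟨_, (EReal.coe_toReal hVt (hVb y)).symm⟩
      rw [hv]
      norm_cast
      ring

end IsBallConj

/-! ### Integrals of extended-real functions. -/

theorem measurable_eReal_abs : Measurable EReal.abs := by
  refine EReal.measurable_of_measurable_real ?_
  simp only [EReal.abs_def]
  fun_prop

theorem IsL1.ae_ne_top {g : EuclideanSpace ℝ (Fin n) → EReal}
    {ν : Measure (EuclideanSpace ℝ (Fin n))} (h : IsL1 g ν) : ∀ᵐ x ∂ν, g x ≠ ⊤ ∧ g x ≠ ⊥ := by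
  have hm : AEMeasurable (fun x => (g x).abs) ν := measurable_eReal_abs.comp_aemeasurable h.1
  filter_upwards [ae_lt_top' hm h.2.ne] with x hx
  constructor <;> intro hx' <;> rw [hx'] at hx <;> simp at hx

theorem IsL1.integrable_toReal {g : EuclideanSpace ℝ (Fin n) → EReal}
    {ν : Measure (EuclideanSpace ℝ (Fin n))} (h : IsL1 g ν) :
    Integrable (fun x => (g x).toReal) ν := by
  refine ⟨h.1.ereal_toReal.aestronglyMeasurable, lt_of_le_of_lt (lintegral_mono_ae ?_) h.2⟩
  filter_upwards [h.ae_ne_top] with x hx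
  lift g x to ℝ using hx with q
  rw [EReal.toReal_coe, EReal.abs_def, Real.enorm_eq_ofReal_abs]

theorem isL1_of_integrable_toReal {g : EuclideanSpace ℝ (Fin n) → EReal}
    {ν : Measure (EuclideanSpace ℝ (Fin n))} (hm : AEMeasurable g ν)
    (hfin : ∀ᵐ x ∂ν, g x ≠ ⊤ ∧ g x ≠ ⊥) (h : Integrable (fun x => (g x).toReal) ν) :
    IsL1 g ν := by
  refine ⟨hm, lt_of_le_of_lt (lintegral_mono_ae ?_) h.2⟩
  filter_upwards [hfin] with x hx
  lift g x to ℝ using hx with q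
  rw [EReal.toReal_coe, EReal.abs_def, Real.enorm_eq_ofReal_abs]

theorem IsL1.eintegral_neg {g : EuclideanSpace ℝ (Fin n) → EReal}
    {ν : Measure (EuclideanSpace ℝ (Fin n))} (h : IsL1 g ν) :
    eintegral (fun x => -g x) ν = ((-∫ x, (g x).toReal ∂ν : ℝ) : EReal) := by
  have hi := h.integrable_toReal
  have e1 : ∫⁻ x, (-g x).toENNReal ∂ν = ∫⁻ x, ENNReal.ofReal (-(g x).toReal) ∂ν := by
    refine lintegral_congr_ae ?_
    filter_upwards [h.ae_ne_top] with x hx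
    lift g x to ℝ using hx with q
    rw [← EReal.coe_neg, EReal.toReal_coe, EReal.toENNReal_of_ne_top (EReal.coe_ne_top _),
      EReal.toReal_coe]
  have e2 : ∫⁻ x, (- -g x).toENNReal ∂ν = ∫⁻ x, ENNReal.ofReal ((g x).toReal) ∂ν := by
    refine lintegral_congr_ae ?_
    filter_upwards [h.ae_ne_top] with x hx
    lift g x to ℝ using hx with q
    rw [neg_neg, EReal.toReal_coe, EReal.toENNReal_of_ne_top (EReal.coe_ne_top _),
      EReal.toReal_coe]
  have f1 : ∫⁻ x, ENNReal.ofReal (-(g x).toReal) ∂ν ≠ ⊤ := hi.neg.lintegral_lt_top.ne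
  have f2 : ∫⁻ x, ENNReal.ofReal ((g x).toReal) ∂ν ≠ ⊤ := hi.lintegral_lt_top.ne
  rw [eintegral, e1, e2, integral_eq_lintegral_pos_part_sub_lintegral_neg_part hi, neg_sub,
    EReal.coe_sub, EReal.coe_ennreal_toReal f1, EReal.coe_ennreal_toReal f2]

theorem neg_le_conj {g : EuclideanSpace ℝ (Fin n) → EReal} {x₀ : EuclideanSpace ℝ (Fin n)}
    {G : ℝ} (hG : g x₀ = G) {R : ℝ} {y : EuclideanSpace ℝ (Fin n)}
    (hy : y ∈ Metric.closedBall (0 : EuclideanSpace ℝ (Fin n)) R) :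
    ((-(‖x₀‖ * R) - G : ℝ) : EReal) ≤ conj g y := by
  have h1 : ((inner ℝ x₀ y : ℝ) : EReal) - g x₀ ≤ conj g y :=
    le_iSup (fun x => (((inner ℝ x y : ℝ) : EReal) - g x)) x₀
  refine le_trans ?_ h1
  rw [hG, ← EReal.coe_sub, EReal.coe_le_coe_iff]
  have h2 := neg_le_of_abs_le (abs_real_inner_le_norm x₀ y)
  have h3 : ‖x₀‖ * ‖y‖ ≤ ‖x₀‖ * R := by
    gcongr; simpa using hy
  linarith

theorem conj_ne_bot {g : EuclideanSpace ℝ (Fin n) → EReal} (hb : ∀ x, g x ≠ ⊥)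
    (ht : ∃ x, g x < ⊤) (y : EuclideanSpace ℝ (Fin n)) : conj g y ≠ ⊥ := by
  obtain ⟨x₀, hx₀⟩ := ht
  have := neg_le_conj (EReal.coe_toReal hx₀.ne (hb x₀)).symm (R := ‖y‖) (y := y) (by simp)
  exact ((EReal.bot_lt_coe _).trans_le this).ne'

theorem exp_neg_add {x y : EReal} (hx : x ≠ ⊥) (hy : y ≠ ⊥) :
    EReal.exp (-(x + y)) = EReal.exp (-y) * EReal.exp (-x) := by
  rw [EReal.neg_add (Or.inl hx) (Or.inr hy), sub_eq_add_neg, EReal.exp_add, mul_comm]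

/-! ### Gibbs measures, moment measures and the subgradient inequality. -/

/-- The measure `e^{-φ} dm`. -/
noncomputable def gibbs (φ : EuclideanSpace ℝ (Fin n) → ℝ)
    (m : Measure (EuclideanSpace ℝ (Fin n))) : Measure (EuclideanSpace ℝ (Fin n)) :=
  m.withDensity fun y => EReal.exp (-(φ y : EReal))

/-- The image of the normalized measure `e^{-φ} dm` under `∇φ`. -/
noncomputable def momentMeasure (φ : EuclideanSpace ℝ (Fin n) → ℝ)
    (m : Measure (EuclideanSpace ℝ (Fin n))) : Measure (EuclideanSpace ℝ (Fin n)) :=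
  ((gibbs φ m Set.univ)⁻¹ • gibbs φ m).map (gradient φ)

theorem gibbs_withDensity {φ : EuclideanSpace ℝ (Fin n) → ℝ} (hφ : Measurable φ)
    {V : EuclideanSpace ℝ (Fin n) → EReal} (hVb : ∀ x, V x ≠ ⊥) (hVm : Measurable V) :
    gibbs φ (volume.withDensity fun x => EReal.exp (-V x)) =
      volume.withDensity fun y => EReal.exp (-((φ y : EReal) + V y)) := by
  have hm : Measurable fun y => EReal.exp (-(φ y : EReal)) :=
    (measurable_coe_real_ereal.comp hφ).neg.ereal_exp
  have hm' : Measurable fun y => EReal.exp (-V y) := hVm.neg.ereal_exp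
  rw [gibbs, ← withDensity_mul _ hm' hm]
  congr 1
  ext y
  rw [exp_neg_add (EReal.coe_ne_bot _) (hVb y)]
  rfl

theorem expConjIntegral_withDensity {g : EuclideanSpace ℝ (Fin n) → EReal}
    (hb : ∀ x, g x ≠ ⊥) (ht : ∃ x, g x < ⊤)
    {V : EuclideanSpace ℝ (Fin n) → EReal} (hVb : ∀ x, V x ≠ ⊥) (hVm : Measurable V) :
    expConjIntegral g (volume.withDensity fun x => EReal.exp (-V x)) =
      ∫⁻ y, EReal.exp (-(conj g y + V y)) := by
  have hm : Measurable fun y => EReal.exp (-V y) := hVm.neg.ereal_exp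
  have hm' : Measurable fun y => EReal.exp (-conj g y) := (measurable_conj hb).neg.ereal_exp
  rw [expConjIntegral, lintegral_withDensity_eq_lintegral_mul _ hm hm']
  refine lintegral_congr fun y => ?_
  rw [exp_neg_add (conj_ne_bot hb ht y) (hVb y)]
  rfl

theorem lintegral_eq_iSup_closedBall {F : EuclideanSpace ℝ (Fin n) → ℝ≥0∞} :
    ∫⁻ y, F y = ⨆ j : ℕ, ∫⁻ y in Metric.closedBall 0 j, F y := by
  have h := Monotone.measure_iUnion (μ := volume.withDensity F)
    (s := fun j : ℕ => Metric.closedBall (0 : EuclideanSpace ℝ (Fin n)) j)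
    (fun i j hij => Metric.closedBall_subset_closedBall (by exact_mod_cast hij))
  rw [Metric.iUnion_closedBall_nat, withDensity_apply _ MeasurableSet.univ,
    setLIntegral_univ] at h
  rw [h]
  simp_rw [withDensity_apply _ Metric.isClosed_closedBall.measurableSet]

/-- `φ` is the Legendre transform of the restriction of `f` to a ball, `dm = e^{-V} dx`, and
the measure `e^{-φ} dm` is nonzero and has an exponentially decaying density. -/
structure IsGibbsPair (f : EuclideanSpace ℝ (Fin n) → EReal) (k : ℕ)
    (φ : EuclideanSpace ℝ (Fin n) → ℝ) (V : EuclideanSpace ℝ (Fin n) → EReal)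
    (m : Measure (EuclideanSpace ℝ (Fin n))) : Prop extends IsBallConj f k φ where
  ne_bot : ∀ x, f x ≠ ⊥
  measurable : Measurable f
  eConvex_potential : EConvex V
  potential_ne_bot : ∀ x, V x ≠ ⊥
  measurable_potential : Measurable V
  measure_eq : m = volume.withDensity fun x => EReal.exp (-V x)
  linear_le : ∃ c A : ℝ, 0 < c ∧ ∀ y, ((c * ‖y‖ + A : ℝ) : EReal) ≤ φ y + V y
  gibbs_univ_ne_zero : gibbs φ m Set.univ ≠ 0

namespace IsGibbsPair

variable {f g : EuclideanSpace ℝ (Fin n) → EReal} {k : ℕ} {φ : EuclideanSpace ℝ (Fin n) → ℝ}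
  {V : EuclideanSpace ℝ (Fin n) → EReal} {m : Measure (EuclideanSpace ℝ (Fin n))}

theorem lintegral_gibbs (h : IsGibbsPair f k φ V m) {F : EuclideanSpace ℝ (Fin n) → ℝ≥0∞}
    (hF : Measurable F) :
    ∫⁻ y, F y ∂(gibbs φ m) = ∫⁻ y, F y * EReal.exp (-((φ y : EReal) + V y)) := by
  have hφ := h.lipschitzWith.continuous.measurable
  have hm : Measurable fun y => EReal.exp (-((φ y : EReal) + V y)) :=
    ((measurable_coe_real_ereal.comp hφ).add h.measurable_potential).neg.ereal_exp
  rw [h.measure_eq, gibbs_withDensity hφ h.potential_ne_bot h.measurable_potential,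
    lintegral_withDensity_eq_lintegral_mul _ hm hF]
  exact lintegral_congr fun y => mul_comm _ _

theorem lintegral_one_add_norm_gibbs (h : IsGibbsPair f k φ V m) :
    ∫⁻ y, ENNReal.ofReal (1 + ‖y‖) ∂(gibbs φ m) < ⊤ := by
  obtain ⟨c, A, hc, hcA⟩ := h.linear_le
  rw [h.lintegral_gibbs (by fun_prop)]
  exact lintegral_one_add_norm_mul_exp_neg_lt_top hc hcA

/-- On a ball V is bounded below, because φ + V is and φ is bounded above there; g* is bounded below
by an affine function. Finiteness allows taking a real logarithm later. -/
theorem setLIntegral_exp_neg_conj_lt_top (h : IsGibbsPair f k φ V m) (hgb : ∀ x, g x ≠ ⊥)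
    (hgt : ∃ x, g x < ⊤) (R : ℝ) :
    ∫⁻ y in Metric.closedBall 0 R, EReal.exp (-(conj g y + V y)) < ⊤ := by
  obtain ⟨x₀, hx₀⟩ := hgt
  have hG := (EReal.coe_toReal hx₀.ne (hgb x₀)).symm
  set G := (g x₀).toReal
  obtain ⟨c, A, hc, hcA⟩ := h.linear_le
  set B : ℝ := (-(‖x₀‖ * R) - G) + (A - φ 0 - k * R)
  refine lt_of_le_of_lt (setLIntegral_mono' (g := fun _ => EReal.exp (-(B : EReal)))
    Metric.isClosed_closedBall.measurableSet fun y hy => ?_) ?_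
  · rw [EReal.exp_le_exp_iff, EReal.neg_le_neg_iff, EReal.coe_add]
    refine add_le_add (neg_le_conj hG hy) ?_
    by_cases hVt : V y = ⊤
    · rw [hVt]; exact le_top
    have h1 := hcA y
    lift V y to ℝ using ⟨hVt, h.potential_ne_bot y⟩ with v
    rw [← EReal.coe_add, EReal.coe_le_coe_iff] at h1
    rw [EReal.coe_le_coe_iff]
    have h2 := h.le_add y
    have h3 : (k : ℝ) * ‖y‖ ≤ k * R := by
      gcongr; simpa using hy
    have h4 : 0 ≤ c * ‖y‖ := by positivity
    linarith
  · rw [setLIntegral_const, ← EReal.coe_neg, EReal.exp_coe]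
    exact ENNReal.mul_lt_top ENNReal.ofReal_lt_top measure_closedBall_lt_top

theorem gibbs_univ_lt_top (h : IsGibbsPair f k φ V m) : gibbs φ m Set.univ < ⊤ := by
  refine lt_of_le_of_lt ?_ h.lintegral_one_add_norm_gibbs
  rw [← lintegral_one]
  exact lintegral_mono fun y => by simp

theorem gibbs_univ_eq (h : IsGibbsPair f k φ V m) :
    gibbs φ m Set.univ = ∫⁻ y, EReal.exp (-((φ y : EReal) + V y)) := by
  rw [h.measure_eq, gibbs_withDensity h.lipschitzWith.continuous.measurable h.potential_ne_bot
    h.measurable_potential, withDensity_apply _ MeasurableSet.univ, setLIntegral_univ]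

/-- The probability measure proportional to `e^{-φ} dm`. -/
noncomputable def prob (φ : EuclideanSpace ℝ (Fin n) → ℝ)
    (m : Measure (EuclideanSpace ℝ (Fin n))) : Measure (EuclideanSpace ℝ (Fin n)) :=
  (gibbs φ m Set.univ)⁻¹ • gibbs φ m

theorem momentMeasure_eq : momentMeasure φ m = (prob φ m).map (gradient φ) := rfl

theorem isProbabilityMeasure_prob (h : IsGibbsPair f k φ V m) :
    IsProbabilityMeasure (prob φ m) :=
  ⟨by rw [prob, Measure.smul_apply, smul_eq_mul,
    ENNReal.inv_mul_cancel h.gibbs_univ_ne_zero h.gibbs_univ_lt_top.ne]⟩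

theorem ae_prob (h : IsGibbsPair f k φ V m) :
    ∀ᵐ y ∂(prob φ m), DifferentiableAt ℝ φ y := by
  have h1 : m ≪ volume := by rw [h.measure_eq]; exact withDensity_absolutelyContinuous _ _
  have h2 : prob φ m ≪ volume :=
    Measure.smul_absolutelyContinuous.trans ((withDensity_absolutelyContinuous m _).trans h1)
  exact h2.ae_le h.ae_differentiableAt

theorem integrable_one_add_norm_prob (h : IsGibbsPair f k φ V m) :
    Integrable (fun y => 1 + ‖y‖) (prob φ m) := by
  refine Integrable.smul_measure ⟨by fun_prop, ?_⟩ (ENNReal.inv_ne_top.2 h.gibbs_univ_ne_zero)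
  refine lt_of_eq_of_lt (lintegral_congr fun y => ?_) h.lintegral_one_add_norm_gibbs
  rw [Real.enorm_eq_ofReal (by positivity)]

/-- The integrand, almost everywhere f(∇φ(y)), grows at most linearly because φ is k-Lipschitz. -/
theorem integrable_inner_gradient_sub (h : IsGibbsPair f k φ V m) :
    Integrable (fun y => inner ℝ (gradient φ y) y - φ y) (prob φ m) := by
  have hφ := h.lipschitzWith.continuous.measurable
  refine (h.integrable_one_add_norm_prob.const_mul (2 * k + |φ 0|)).mono'
    ((((measurable_gradient φ).inner measurable_id).sub hφ).aestronglyMeasurable) ?_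
  filter_upwards [h.ae_prob] with y hy
  have hx := (h.gradient_spec hy).1
  have h1 : ‖(inner ℝ (gradient φ y) y : ℝ)‖ ≤ k * ‖y‖ := by
    refine (norm_inner_le_norm _ _).trans ?_
    gcongr; simpa using hx
  have h2 := h.le_add y
  have h3 := h.sub_le_self y
  rw [Real.norm_eq_abs] at h1 ⊢
  rw [abs_le] at h1 ⊢
  have h4 := neg_abs_le (φ 0)
  have h5 := le_abs_self (φ 0)
  have h6 : 0 ≤ |φ 0| * ‖y‖ := by positivity
  have h7 : (0 : ℝ) ≤ k := Nat.cast_nonneg k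
  constructor <;> nlinarith

theorem integrable_toReal_comp_gradient (h : IsGibbsPair f k φ V m) :
    Integrable (fun y => (f (gradient φ y)).toReal) (prob φ m) := by
  refine h.integrable_inner_gradient_sub.congr ?_
  filter_upwards [h.ae_prob] with y hy
  exact (h.gradient_spec hy).2.2.symm

theorem isL1 (h : IsGibbsPair f k φ V m) : IsL1 f (momentMeasure φ m) := by
  have hT : AEMeasurable (gradient φ) (prob φ m) := (measurable_gradient φ).aemeasurable
  have hset : MeasurableSet {x | f x ≠ ⊤ ∧ f x ≠ ⊥} :=
    (h.measurable (measurableSet_singleton ⊤).compl).inter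
      (h.measurable (measurableSet_singleton ⊥).compl)
  refine isL1_of_integrable_toReal h.measurable.aemeasurable ?_ ?_
  · refine (ae_map_iff hT hset).2 ?_
    filter_upwards [h.ae_prob] with y hy
    exact ⟨(h.gradient_spec hy).2.1.ne, h.ne_bot _⟩
  · exact (integrable_map_measure h.measurable.ereal_toReal.aestronglyMeasurable hT).2
      h.integrable_toReal_comp_gradient

theorem momentMeasure_mem_P1 (h : IsGibbsPair f k φ V m) : momentMeasure φ m ∈ P1 n := by
  have := h.isProbabilityMeasure_prob
  have hT := measurable_gradient φ
  rw [momentMeasure_eq]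
  refine ⟨Measure.isProbabilityMeasure_map hT.aemeasurable, ?_⟩
  refine lt_of_eq_of_lt (lintegral_map measurable_enorm hT) ?_
  refine lt_of_le_of_lt (lintegral_mono_ae (g := fun _ => ENNReal.ofReal k) ?_) ?_
  · filter_upwards [h.ae_prob] with y hy
    rw [← ofReal_norm]
    have := (h.gradient_spec hy).1
    exact ENNReal.ofReal_le_ofReal (by simpa using this)
  · rw [lintegral_const, measure_univ, mul_one]; exact ENNReal.ofReal_lt_top

theorem integrable_toReal_gradient_of_isL1 (hg : IsL1 g (momentMeasure φ m)) :
    Integrable (fun y => (g (gradient φ y)).toReal) (prob φ m) :=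
  (integrable_map_measure hg.integrable_toReal.aestronglyMeasurable
    (measurable_gradient φ).aemeasurable).1 hg.integrable_toReal

theorem integral_toReal_momentMeasure (hg : IsL1 g (momentMeasure φ m)) :
    ∫ x, (g x).toReal ∂(momentMeasure φ m) = ∫ y, (g (gradient φ y)).toReal ∂(prob φ m) :=
  integral_map (measurable_gradient φ).aemeasurable hg.integrable_toReal.aestronglyMeasurable

theorem ae_min_toReal (hg : IsL1 g (momentMeasure φ m)) (c : ℝ) :
    ∀ᵐ y ∂(prob φ m), (min (g (gradient φ y)) (c : EReal)).toReal =
      min (g (gradient φ y)).toReal c := by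
  filter_upwards [ae_of_ae_map (measurable_gradient φ).aemeasurable hg.ae_ne_top] with y hy
  lift g (gradient φ y) to ℝ using hy with q
  rw [← EReal.coe_strictMono.monotone.map_min, EReal.toReal_coe, EReal.toReal_coe]

theorem integrable_truncDiff (h : IsGibbsPair f k φ V m) (hg : IsL1 g (momentMeasure φ m))
    (c : ℝ) : Integrable (IsBallConj.truncDiff φ g c) (prob φ m) := by
  have := h.isProbabilityMeasure_prob
  refine Integrable.sub ?_ h.integrable_inner_gradient_sub
  refine ((integrable_toReal_gradient_of_isL1 hg).inf (integrable_const c)).congr ?_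
  filter_upwards [ae_min_toReal hg c] with y hy
  rw [hy]
  rfl

theorem integral_truncDiff_le (h : IsGibbsPair f k φ V m) (hg : IsL1 g (momentMeasure φ m))
    (c : ℝ) : ∫ y, IsBallConj.truncDiff φ g c y ∂(prob φ m) ≤
      ∫ x, (g x).toReal ∂(momentMeasure φ m) - ∫ x, (f x).toReal ∂(momentMeasure φ m) := by
  rw [integral_toReal_momentMeasure hg, integral_toReal_momentMeasure h.isL1,
    ← integral_sub (integrable_toReal_gradient_of_isL1 hg) h.integrable_toReal_comp_gradient]
  refine integral_mono_ae (h.integrable_truncDiff hg c)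
    ((integrable_toReal_gradient_of_isL1 hg).sub h.integrable_toReal_comp_gradient) ?_
  filter_upwards [h.ae_prob, ae_min_toReal hg c] with y hy hy'
  rw [IsBallConj.truncDiff, hy', (h.gradient_spec hy).2.2]
  gcongr
  exact min_le_left _ _

theorem ae_truncDiff_le (h : IsGibbsPair f k φ V m) (hg : IsL1 g (momentMeasure φ m)) (c : ℝ) :
    ∀ᵐ y ∂(prob φ m), IsBallConj.truncDiff φ g c y ≤ c + φ 0 := by
  filter_upwards [h.ae_prob, ae_min_toReal hg c] with y hy hy'
  obtain ⟨hx, hfx, hfe⟩ := h.gradient_spec hy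
  have h1 := h.inner_sub_le _ hx hfx 0
  rw [inner_zero_right, hfe] at h1
  rw [IsBallConj.truncDiff, hy']
  have := min_le_right (g (gradient φ y)).toReal c
  linarith

/-- Working on a ball bounds ⟨x, y⟩ - g*(y) above, so g can be truncated and the exponent
differentiated. The final bound involves neither the truncation level nor R. -/
theorem setLIntegral_exp_neg_conj_le (h : IsGibbsPair f k φ V m) (hgb : ∀ x, g x ≠ ⊥)
    (hgt : ∃ x, g x < ⊤) (hgm : Measurable g) (hg : IsL1 g (momentMeasure φ m)) (R : ℝ) :
    ∫⁻ y in Metric.closedBall 0 R, EReal.exp (-(conj g y + V y)) ≤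
      gibbs φ m Set.univ * EReal.exp ((∫ x, (g x).toReal ∂(momentMeasure φ m) -
        ∫ x, (f x).toReal ∂(momentMeasure φ m) : ℝ) : EReal) := by
  have := h.isProbabilityMeasure_prob
  set I := ∫⁻ y in Metric.closedBall 0 R, EReal.exp (-(conj g y + V y)) with hI
  by_cases hI0 : I = 0
  · rw [hI0]; exact zero_le
  have hIt : I < ⊤ := h.setLIntegral_exp_neg_conj_lt_top hgb hgt R
  have exists_exp : ∀ z : ℝ≥0∞, z ≠ 0 → z ≠ ⊤ → ∃ ζ : ℝ, z = EReal.exp (ζ : EReal) := by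
    intro z h0 ht
    refine ⟨(ENNReal.log z).toReal, ?_⟩
    rw [EReal.coe_toReal (by simpa using ht) (by simpa using h0), ENNReal.exp_log]
  obtain ⟨ζ, hζ⟩ := exists_exp _ h.gibbs_univ_ne_zero h.gibbs_univ_lt_top.ne
  obtain ⟨ξ, hξ⟩ := exists_exp _ hI0 hIt.ne
  obtain ⟨x₀, hx₀⟩ := id hgt
  have hG := (EReal.coe_toReal hx₀.ne (hgb x₀)).symm
  set G := (g x₀).toReal
  -- Sum of the bounds ⟨x, y⟩ ≤ kR and -g*(y) ≤ ‖x₀‖R + G on the two balls.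
  set c : ℝ := k * R + ‖x₀‖ * R + G with hcdef
  have hc : ∀ x ∈ Metric.closedBall (0 : EuclideanSpace ℝ (Fin n)) k,
      ∀ y ∈ Metric.closedBall (0 : EuclideanSpace ℝ (Fin n)) R,
        ((inner ℝ x y - c : ℝ) : EReal) ≤ conj g y := by
    intro x hx y hy
    refine le_trans (EReal.coe_le_coe_iff.2 ?_) (neg_le_conj hG hy)
    have h1 := real_inner_le_norm x y
    have h2 : ‖x‖ * ‖y‖ ≤ k * R := by
      gcongr
      · simpa using hx
      · simpa using hy
    linarith
  -- Dividing Prékopa–Leindler by the total mass e^ζ gives e^{t(ξ-ζ)} ≤ ∫e^{tw} against the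
  -- probability measure, for every t in (0,1).
  have key : ξ - ζ ≤ ∫ y, IsBallConj.truncDiff φ g c y ∂(prob φ m) := by
    refine le_integral_of_exp_le (h.integrable_truncDiff hg c) (h.ae_truncDiff_le hg c)
      fun t ht0 ht1 => ?_
    have hPL := h.prekopaLeindler_truncDiff h.eConvex_potential h.potential_ne_bot
      h.measurable_potential hgb hgm hc (a := 1 - t) (t := t) (by linarith) ht0 (by ring)
    have hw := h.measurable_truncDiff hgm c
    rw [← h.gibbs_univ_eq, ← hI, hζ, hξ, ← EReal.exp_mul, ← EReal.exp_mul, ← EReal.exp_add] at hPL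
    rw [prob, lintegral_smul_measure, hζ, ← EReal.exp_neg, h.lintegral_gibbs (by fun_prop),
      smul_eq_mul]
    calc ENNReal.ofReal (Real.exp (t * (ξ - ζ)))
        = EReal.exp (-(ζ : EReal)) * EReal.exp ((ζ : EReal) * ((1 - t : ℝ) : EReal) +
            (ξ : EReal) * (t : EReal)) := by
          rw [← EReal.exp_add, ← EReal.exp_coe]
          congr 1
          norm_cast
          ring
      _ ≤ _ := by
          gcongr
  have h1 := key.trans (h.integral_truncDiff_le hg c)
  rw [hζ, hξ, ← EReal.exp_add, EReal.exp_le_exp_iff, ← EReal.coe_add, EReal.coe_le_coe_iff]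
  linarith

/-- The measure `∇φ_# (e^{-φ} dm)` is a subgradient of `L(·|m)` at `f`. -/
theorem expConjIntegral_le (h : IsGibbsPair f k φ V m) (hg' : IsProperConvexLSC g)
    (hg : IsL1 g (momentMeasure φ m)) :
    expConjIntegral g m ≤
      gibbs φ m Set.univ * EReal.exp ((∫ x, (g x).toReal ∂(momentMeasure φ m) -
        ∫ x, (f x).toReal ∂(momentMeasure φ m) : ℝ) : EReal) := by
  have h1 := expConjIntegral_withDensity hg'.ne_bot hg'.exists_lt_top h.potential_ne_bot
    h.measurable_potential
  rw [← h.measure_eq] at h1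
  rw [h1, lintegral_eq_iSup_closedBall]
  exact iSup_le fun j => h.setLIntegral_exp_neg_conj_le hg'.ne_bot hg'.exists_lt_top
    hg'.lsc.measurable hg j

theorem K_le (h : IsGibbsPair f k φ V m) :
    K (momentMeasure φ m) m ≤ ((-∫ x, (f x).toReal ∂(momentMeasure φ m) : ℝ) : EReal) +
      ENNReal.log (gibbs φ m Set.univ) := by
  refine iSup₂_le fun g hg => ?_
  have h1 := ENNReal.log_le_log (h.expConjIntegral_le hg.2 hg.1)
  rw [ENNReal.log_mul_add, EReal.log_exp] at h1
  obtain ⟨ζ, hζ⟩ : ∃ ζ : ℝ, ENNReal.log (gibbs φ m Set.univ) = ζ := by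
    refine ⟨(ENNReal.log (gibbs φ m Set.univ)).toReal, (EReal.coe_toReal ?_ ?_).symm⟩
    · simpa using h.gibbs_univ_lt_top.ne
    · simpa using h.gibbs_univ_ne_zero
  rw [hg.1.eintegral_neg, L, sub_eq_add_neg, neg_neg]
  refine (add_le_add_right h1 _).trans_eq ?_
  rw [hζ]
  norm_cast
  ring

theorem neg_log_le (h : IsGibbsPair f k φ V m) :
    -ENNReal.log (gibbs φ m Set.univ) ≤
      eintegral (fun x => -f x) (momentMeasure φ m) - K (momentMeasure φ m) m := by
  rw [h.isL1.eintegral_neg]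
  refine le_trans ?_ (EReal.sub_le_sub le_rfl h.K_le)
  obtain ⟨ζ, hζ⟩ : ∃ ζ : ℝ, ENNReal.log (gibbs φ m Set.univ) = ζ := by
    refine ⟨(ENNReal.log (gibbs φ m Set.univ)).toReal, (EReal.coe_toReal ?_ ?_).symm⟩
    · simpa using h.gibbs_univ_lt_top.ne
    · simpa using h.gibbs_univ_ne_zero
  rw [hζ]
  norm_cast
  linarith

end IsGibbsPair

/-! ### Invariance, the upper bound and the passage to the limit. -/

theorem momentMeasure_map_isometry {φ : EuclideanSpace ℝ (Fin n) → ℝ}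
    {m : Measure (EuclideanSpace ℝ (Fin n))}
    (S : EuclideanSpace ℝ (Fin n) ≃ₗᵢ[ℝ] EuclideanSpace ℝ (Fin n)) (hφm : Measurable φ)
    (hφ : ∀ y, φ (S y) = φ y) (hm : m.map S = m) :
    (momentMeasure φ m).map S = momentMeasure φ m := by
  have hS : Measurable S := S.continuous.measurable
  have hT := measurable_gradient φ
  have hE : Measurable fun y => EReal.exp (-(φ y : EReal)) :=
    (measurable_coe_real_ereal.comp hφm).neg.ereal_exp
  have hgibbs : (gibbs φ m).map S = gibbs φ m := by
    ext s hs
    rw [Measure.map_apply hS hs, gibbs, withDensity_apply _ (hS hs), withDensity_apply _ hs]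
    conv_rhs => rw [← hm]
    rw [setLIntegral_map hs hE hS]
    simp_rw [hφ]
  rw [momentMeasure, Measure.map_map hS hT]
  have : S ∘ gradient φ = gradient φ ∘ S := by
    ext1 y; exact (gradient_comp_isometry S hφ y).symm
  rw [this, ← Measure.map_map hT hS, Measure.map_smul, hgibbs]

/-- Finiteness of f* at y bounds f below by an affine function, so the negative part of f is
ν-integrable and only the positive part can have infinite integral. -/
theorem eintegral_neg_eq_bot {f : EuclideanSpace ℝ (Fin n) → EReal}
    {ν : Measure (EuclideanSpace ℝ (Fin n))} (hν : ν ∈ P1 n) (hfb : ∀ x, f x ≠ ⊥)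
    (hfm : Measurable f) {y : EuclideanSpace ℝ (Fin n)} (hy : conj f y < ⊤) (hf : ¬ IsL1 f ν) :
    eintegral (fun x => -f x) ν = ⊥ := by
  have := hν.1
  obtain ⟨G, hG, -⟩ := EReal.lt_iff_exists_real_btwn.1 hy
  have hle : ∀ x, (-f x).toENNReal ≤ ENNReal.ofReal |G| + ENNReal.ofReal ‖y‖ * ‖x‖ₑ := by
    intro x
    by_cases htop : f x = ⊤
    · simp [htop]
    have h1 : ((inner ℝ x y : ℝ) : EReal) - f x ≤ G :=
      (le_iSup (fun x => (((inner ℝ x y : ℝ) : EReal) - f x)) x).trans hG.le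
    lift f x to ℝ using ⟨htop, hfb x⟩ with q
    rw [← EReal.coe_sub, EReal.coe_le_coe_iff] at h1
    rw [← EReal.coe_neg, EReal.toENNReal_of_ne_top (EReal.coe_ne_top _), EReal.toReal_coe,
      ← ofReal_norm, ← ENNReal.ofReal_mul (norm_nonneg _),
      ← ENNReal.ofReal_add (abs_nonneg _) (by positivity)]
    refine ENNReal.ofReal_le_ofReal ?_
    have h2 := neg_le_of_abs_le (abs_real_inner_le_norm x y)
    have h3 := le_abs_self G
    linarith
  have hfin : ∫⁻ x, (-f x).toENNReal ∂ν < ⊤ := by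
    refine lt_of_le_of_lt (lintegral_mono hle) ?_
    rw [lintegral_add_left measurable_const, lintegral_const_mul _ measurable_enorm,
      lintegral_const, measure_univ, mul_one]
    exact ENNReal.add_lt_top.2 ⟨ENNReal.ofReal_lt_top,
      ENNReal.mul_lt_top ENNReal.ofReal_lt_top hν.2⟩
  have hinf : ∫⁻ x, (- -f x).toENNReal ∂ν = ⊤ := by
    by_contra hne
    refine hf ⟨hfm.aemeasurable, lt_of_le_of_lt (lintegral_mono
      (g := fun x => (-f x).toENNReal + (- -f x).toENNReal) fun x => ?_) ?_⟩
    · change (f x).abs ≤ (-f x).toENNReal + (- -f x).toENNReal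
      rw [neg_neg]
      by_cases htop : f x = ⊤
      · simp [htop]
      lift f x to ℝ using ⟨htop, hfb x⟩ with q
      rw [← EReal.coe_neg, EReal.toENNReal_of_ne_top (EReal.coe_ne_top _),
        EReal.toENNReal_of_ne_top (EReal.coe_ne_top _), EReal.toReal_coe, EReal.toReal_coe,
        EReal.abs_def]
      rcases abs_choice q with h | h <;> rw [h]
      · exact le_add_self
      · exact le_self_add
    · rw [lintegral_add_left
        (show Measurable fun x => (-f x).toENNReal from hfm.neg.ereal_toENNReal)]
      exact ENNReal.add_lt_top.2 ⟨hfin, lt_top_iff_ne_top.2 hne⟩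
  rw [eintegral, hinf, EReal.coe_ennreal_top, EReal.sub_top]

theorem eintegral_sub_K_le {m ν : Measure (EuclideanSpace ℝ (Fin n))}
    {f : EuclideanSpace ℝ (Fin n) → EReal} (hf : IsProperConvexLSC f)
    (hpos : 0 < expConjIntegral f m) (hν : ν ∈ P1 n) :
    eintegral (fun x => -f x) ν - K ν m ≤ L f m := by
  by_cases h : IsL1 f ν
  · have hK : eintegral (fun x => -f x) ν - L f m ≤ K ν m :=
      le_iSup₂_of_le (f := fun g (_ : g ∈ {g : EuclideanSpace ℝ (Fin n) → EReal |
        IsL1 g ν ∧ IsProperConvexLSC g}) => eintegral (fun x => -g x) ν - L g m) f ⟨h, hf⟩ le_rfl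
    refine (EReal.sub_le_sub le_rfl hK).trans ?_
    rw [h.eintegral_neg]
    induction L f m with
    | bot => simp
    | top => simp
    | coe l => norm_cast; simp
  · obtain ⟨y, hy⟩ : ∃ y, conj f y < ⊤ := by
      by_contra! hcon
      refine hpos.ne' ?_
      rw [expConjIntegral]
      have : ∀ y, conj f y = ⊤ := fun y => top_le_iff.1 (hcon y)
      simp [this]
    -- In `EReal` adding anything to ⊥, even ⊤, gives ⊥; this is the convention of the statement.
    rw [eintegral_neg_eq_bot hν hf.ne_bot hf.lsc.measurable hy h, sub_eq_add_neg, EReal.bot_add]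
    exact bot_le

theorem IsLogConcave.exists_measurable {m : Measure (EuclideanSpace ℝ (Fin n))}
    (hm : IsLogConcave m) : ∃ V : EuclideanSpace ℝ (Fin n) → EReal, EConvex V ∧ (∀ x, V x ≠ ⊥) ∧
      Measurable V ∧ m = volume.withDensity fun x => EReal.exp (-V x) := by
  obtain ⟨V, hVb, hV, rfl⟩ := hm
  obtain ⟨V', h1, h2, h3, h4⟩ := hV.exists_measurable hVb
  refine ⟨V', h1, h2, h3, withDensity_congr_ae ?_⟩
  filter_upwards [h4] with x hx
  rw [hx]

theorem iSup_add_of_ne_bot {a : ℕ → EReal} {v : EReal} (ha : ∀ k, a k ≠ ⊥) (hv : v ≠ ⊥) :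
    ⨆ k, (a k + v) = (⨆ k, a k) + v := by
  have hs : ⨆ k, a k ≠ ⊥ := fun h => ha 0 (le_bot_iff.1 (h ▸ le_iSup a 0))
  induction v with
  | bot => exact absurd rfl hv
  | top => simp [EReal.add_top_of_ne_bot, ha, hs]
  | coe v =>
    apply le_antisymm
    · exact iSup_le fun k => by gcongr; exact le_iSup a k
    · rw [← EReal.le_sub_iff_add_le (Or.inl (EReal.coe_ne_bot v)) (Or.inl (EReal.coe_ne_top v))]
      refine iSup_le fun k => ?_
      rw [EReal.le_sub_iff_add_le (Or.inl (EReal.coe_ne_bot v)) (Or.inl (EReal.coe_ne_top v))]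
      exact le_iSup (fun k => a k + (v : EReal)) k

/-- Approximation of `L(f|m)` by the restrictions of `f` to balls. -/
theorem exists_isGibbsPair_tendsto {m : Measure (EuclideanSpace ℝ (Fin n))}
    (hm : IsLogConcave m) {f : EuclideanSpace ℝ (Fin n) → EReal} (hf : IsProperConvexLSC f)
    (hpos : 0 < expConjIntegral f m) (hfin : expConjIntegral f m ≠ ⊤) :
    ∃ (V : EuclideanSpace ℝ (Fin n) → EReal) (N : ℕ),
      (∀ k, IsGibbsPair f (k + N) (fun y => (ballConj f (k + N) y).toReal) V m) ∧
      Filter.Tendsto (fun k => gibbs (fun y => (ballConj f (k + N) y).toReal) m Set.univ)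
        Filter.atTop (nhds (expConjIntegral f m)) := by
  obtain ⟨V, hV, hVb, hVm, hmV⟩ := hm.exists_measurable
  obtain ⟨x₀, hx₀⟩ := hf.exists_lt_top
  obtain ⟨N₀, hN₀⟩ := exists_nat_ge ‖x₀‖
  set φ : ℕ → EuclideanSpace ℝ (Fin n) → ℝ := fun k y => (ballConj f k y).toReal with hφdef
  have hφ : ∀ k, IsBallConj f (k + N₀) (φ (k + N₀)) ∧
      ∀ y, (φ (k + N₀) y : EReal) = ballConj f (k + N₀) y := fun k =>
    isBallConj_toReal hf.ne_bot hf.lsc ⟨x₀, by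
      simp only [mem_closedBall_zero_iff, Nat.cast_add]
      have : (0 : ℝ) ≤ k := Nat.cast_nonneg k
      linarith, hx₀⟩
  set W : ℕ → EuclideanSpace ℝ (Fin n) → EReal := fun k y => (φ (k + N₀) y : EReal) + V y with hW
  have hφmeas : ∀ k, Measurable fun y => (φ (k + N₀) y : EReal) := fun k =>
    measurable_coe_real_ereal.comp (hφ k).1.lipschitzWith.continuous.measurable
  have hWm : ∀ k, Measurable (W k) := fun k => (hφmeas k).add hVm
  have hWmono : Monotone W := by
    intro i j hij y
    simp only [hW, (hφ i).2, (hφ j).2]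
    gcongr
    exact ballConj_mono f (by lia) y
  have hsup : ∀ y, ⨆ k, W k y = conj f y + V y := by
    intro y
    rw [hW, iSup_add_of_ne_bot (fun k => EReal.coe_ne_bot _) (hVb y)]
    congr 1
    simp_rw [(hφ _).2, ← iSup_ballConj f y]
    exact Monotone.iSup_nat_add (f := fun k => ballConj f k y)
      (fun i j hij => ballConj_mono f hij y) N₀
  have hZ : expConjIntegral f m = ∫⁻ y, EReal.exp (-⨆ k, W k y) := by
    rw [hmV, expConjIntegral_withDensity hf.ne_bot hf.exists_lt_top hVb hVm]
    simp_rw [hsup]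
  have hWE : ∀ k, Measurable fun y => EReal.exp (-W k y) := fun k => (hWm k).neg.ereal_exp
  -- From N₁ on the integrals are finite, as convergence along a decreasing sequence requires; N₀
  -- made the balls meet the domain of f.
  obtain ⟨N₁, hN₁⟩ := Filter.eventually_atTop.1 (EConvex.eventually_exists_linear_le
    (fun k => (hφ k).1.eConvex.add hV)
    (fun k y => EReal.add_ne_bot_iff.2 ⟨EReal.coe_ne_bot _, hVb y⟩) hWm hWmono
    (hZ ▸ hpos.ne') (hZ ▸ hfin))
  have hgibbs : ∀ k, gibbs (φ (k + N₀)) m Set.univ = ∫⁻ y, EReal.exp (-W k y) := by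
    intro k
    rw [hmV, gibbs_withDensity (hφ k).1.lipschitzWith.continuous.measurable hVb hVm,
      withDensity_apply _ MeasurableSet.univ, setLIntegral_univ]
  have hpair : ∀ k, IsGibbsPair f (k + N₁ + N₀) (φ (k + N₁ + N₀)) V m := by
    intro k
    refine ⟨(hφ _).1, hf.ne_bot, hf.lsc.measurable, hV, hVb, hVm, hmV, hN₁ _ (by lia), ?_⟩
    rw [hgibbs]
    refine (lt_of_lt_of_le (hZ ▸ hpos) (lintegral_mono fun y => ?_)).ne'
    rw [EReal.exp_le_exp_iff, EReal.neg_le_neg_iff]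
    exact le_iSup (fun k => W k y) (k + N₁)
  refine ⟨V, N₁ + N₀, fun k => by rw [← add_assoc]; exact hpair k, ?_⟩
  have hlim : Filter.Tendsto (fun k => ∫⁻ y, EReal.exp (-W (k + N₁) y)) Filter.atTop
      (nhds (∫⁻ y, EReal.exp (-⨆ k, W k y))) := by
    refine lintegral_tendsto_of_tendsto_of_antitone (fun k => (hWE _).aemeasurable)
      (Filter.Eventually.of_forall fun y i j hij => ?_) ?_
      (Filter.Eventually.of_forall fun y => ?_)
    · rw [EReal.exp_le_exp_iff, EReal.neg_le_neg_iff]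
      exact hWmono (by lia) y
    · rw [← hgibbs]
      exact (hpair 0).gibbs_univ_lt_top.ne
    · have h1 : Filter.Tendsto (fun k => W k y) Filter.atTop (nhds (⨆ k, W k y)) :=
        tendsto_atTop_iSup fun i j hij => hWmono hij y
      have h2 := (ENNReal.continuous_exp.comp continuous_neg).tendsto (⨆ k, W k y)
      exact h2.comp ((Filter.tendsto_add_atTop_iff_nat N₁).2 h1)
  rw [hZ]
  refine hlim.congr fun k => ?_
  rw [← hgibbs, ← add_assoc]

theorem L_le_iSup {m : Measure (EuclideanSpace ℝ (Fin n))}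
    (hm : IsLogConcave m) {f : EuclideanSpace ℝ (Fin n) → EReal} (hf : IsProperConvexLSC f)
    (hpos : 0 < expConjIntegral f m) {Q : Set (Measure (EuclideanSpace ℝ (Fin n)))}
    (hQ : ∀ k V, IsGibbsPair f k (fun y => (ballConj f k y).toReal) V m →
      momentMeasure (fun y => (ballConj f k y).toReal) m ∈ Q) :
    L f m ≤ ⨆ ν ∈ Q, (eintegral (fun x => -f x) ν - K ν m) := by
  by_cases hfin : expConjIntegral f m = ⊤
  -- Here L(f|m) = ⊥.
  · simp [L, hfin]
  obtain ⟨V, N, hpair, hlim⟩ := exists_isGibbsPair_tendsto hm hf hpos hfin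
  refine le_of_tendsto
    ((continuous_neg.comp ENNReal.continuous_log).tendsto (expConjIntegral f m) |>.comp hlim)
    (Filter.Eventually.of_forall fun k => ?_)
  exact le_iSup₂_of_le (f := fun ν (_ : ν ∈ Q) => eintegral (fun x => -f x) ν - K ν m) _
    (hQ _ V (hpair k)) (hpair k).neg_log_le

/-- Leaving Q free covers all three suprema at once: Q only has to contain the moment measures. -/
theorem iSup_eq_L {m : Measure (EuclideanSpace ℝ (Fin n))}
    (hm : IsLogConcave m) {f : EuclideanSpace ℝ (Fin n) → EReal} (hf : IsProperConvexLSC f)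
    (hpos : 0 < expConjIntegral f m) {Q : Set (Measure (EuclideanSpace ℝ (Fin n)))}
    (hQP : Q ⊆ P1 n)
    (hQ : ∀ k V, IsGibbsPair f k (fun y => (ballConj f k y).toReal) V m →
      momentMeasure (fun y => (ballConj f k y).toReal) m ∈ Q) :
    ⨆ ν ∈ Q, (eintegral (fun x => -f x) ν - K ν m) = L f m :=
  le_antisymm (iSup₂_le fun _ hν => eintegral_sub_K_le hf hpos (hQP hν))
    (L_le_iSup hm hf hpos hQ)

theorem IsGibbsPair.momentMeasure_map {m : Measure (EuclideanSpace ℝ (Fin n))}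
    {f V : EuclideanSpace ℝ (Fin n) → EReal} {k : ℕ}
    (h : IsGibbsPair f k (fun y => (ballConj f k y).toReal) V m)
    (S : EuclideanSpace ℝ (Fin n) ≃ₗᵢ[ℝ] EuclideanSpace ℝ (Fin n)) (hf : ∀ x, f (S x) = f x)
    (hm : m.map S = m) :
    (momentMeasure (fun y => (ballConj f k y).toReal) m).map S =
      momentMeasure (fun y => (ballConj f k y).toReal) m :=
  momentMeasure_map_isometry S h.lipschitzWith.continuous.measurable
    (fun y => by rw [ballConj_comp_isometry S hf]) hm

/-- A sign change of the coordinates, as a linear isometry. -/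
noncomputable def signFlipIsometry (ε : Fin n → ℝ) (hε : IsSigns ε) :
    EuclideanSpace ℝ (Fin n) ≃ₗᵢ[ℝ] EuclideanSpace ℝ (Fin n) where
  toFun := signFlip ε
  invFun := signFlip ε
  map_add' x y := by ext i; simp [signFlip, mul_add]
  map_smul' c x := by ext i; simp [signFlip, mul_left_comm]
  left_inv x := by
    ext i
    rcases hε i with h | h <;> simp [signFlip, h]
  right_inv x := by
    ext i
    rcases hε i with h | h <;> simp [signFlip, h]
  norm_map' x := by
    change ‖signFlip ε x‖ = ‖x‖
    rw [EuclideanSpace.norm_eq, EuclideanSpace.norm_eq]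
    congr 1
    refine Finset.sum_congr rfl fun i _ => ?_
    rcases hε i with h | h <;> simp [signFlip, h]

end ReverseDuality

theorem theorem2p11 (n : ℕ) (m : MeasureTheory.Measure (EuclideanSpace ℝ (Fin n)))
    (hm : ReverseDuality.IsLogConcave m)
    (f : EuclideanSpace ℝ (Fin n) → EReal) (hf : ReverseDuality.IsProperConvexLSC f)
    (hpos : 0 < ReverseDuality.expConjIntegral f m) :
    (⨆ ν ∈ ReverseDuality.P1 n,
        (ReverseDuality.eintegral (fun x => -f x) ν - ReverseDuality.K ν m)) =
      ReverseDuality.L f m ∧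
    (ReverseDuality.UnconditionalMeasure m → ReverseDuality.UnconditionalFun f →
      (⨆ ν ∈ {ν | ν ∈ ReverseDuality.P1 n ∧ ReverseDuality.UnconditionalMeasure ν},
          (ReverseDuality.eintegral (fun x => -f x) ν - ReverseDuality.K ν m)) =
        ReverseDuality.L f m) ∧
    (ReverseDuality.SymmetricMeasure m → ReverseDuality.SymmetricFun f →
      (⨆ ν ∈ {ν | ν ∈ ReverseDuality.P1 n ∧ ReverseDuality.SymmetricMeasure ν},
          (ReverseDuality.eintegral (fun x => -f x) ν - ReverseDuality.K ν m)) =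
        ReverseDuality.L f m) := by
  open ReverseDuality in
  refine ⟨iSup_eq_L hm hf hpos subset_rfl fun k V h => h.momentMeasure_mem_P1,
    fun hmu hfu => iSup_eq_L hm hf hpos (fun ν hν => hν.1) fun k V h =>
      ⟨h.momentMeasure_mem_P1, fun ε hε =>
        h.momentMeasure_map (signFlipIsometry ε hε) (hfu ε hε) (hmu ε hε)⟩,
    fun hms hfs => iSup_eq_L hm hf hpos (fun ν hν => hν.1) fun k V h =>
      ⟨h.momentMeasure_mem_P1,
        h.momentMeasure_map (LinearIsometryEquiv.neg ℝ) hfs hms⟩⟩
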